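/- **Setting.** There are $n\ge 1$ agents and $m\ge 1$ identical indivisible items, with $4\mid m$. An adversary fixes time frames $[a_i,d_i]$, $1\le i\le n$, with $a_1<\dots<a_n$ and $a_i\le d_i$, and pairs $(v_t,b_t)$, $1\le t\le n$, of a value per item $v_t\ge 0$ and a budget $b_t\ge 0$, such that $v_t>0$ and $b_t>0$ for at least one $t$. A uniformly random permutation matches the pairs with the time frames. Agents are identified with their pairs and report truthfully; $N$ is the set of all agents. **Benchmarks.** For a set $S$ of agents, a number $k\geq 0$ of items and a price $p>0$ let $R(S,k,p)=\min\bigl(\sum_{i\in S,\,v_i\ge p} b_i/p,\;k\bigr)\cdot p$. Let $p^*_{S,k}>0$ be an (arbitrary) maximizer of $R(S,k,\cdot)$ over positive prices and $OPT(S,k)=R(S,k,p^*_{S,k})$. Let $OPT^*(S,k)$ be the maximum of $\sum_{i\in S}x_ip_i$ over all prices $0\le p_i\le v_i$ and quantities $x_i\ge 0$ with $x_ip_i\le b_i$ for all $i \in S$ and $\sum_{i\in S} x_i\le k$. Put $OPT^*=OPT^*(N,m)$ and $\varepsilon=\max_{i\in N} b_i/OPT(N,m)$. **Procedure $\mathrm{Indiv\_Alloc}(S,p,k)$.**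 Start with $k'=k$ and $x_i=\tilde x_i=0$ for all $i\in S$. Process the agents of $S$ in uniformly random order. When $i$ is processed and $v_i\ge p$: if $k'\le b_i/p$, set $x_i=\tilde x_i=k'$; otherwise set $\tilde x_i=b_i/p$ and, by an independent lottery, $x_i=\lceil b_i/p\rceil$ with probability $b_i/p-\lfloor b_i/p\rfloor$ and $x_i=\lfloor b_i/p\rfloor$ with the remaining probability. In either case replace $k'$ by $k'-x_i$. Return $(x,\tilde x)$. **Mechanism $\mathrm{Rev\_Indiv}(N,m)$.** Write $P(S)=p^*_{S,m/4}$. Toss $n-1$ independent fair coins; let $J$ be one plus the number of tails, let $j$ be the $J$-th agent to arrive and $t_0$ her arrival time, let $A$ be the set of the first $J$ agents to arrive and $B=N\setminus A$. * *Sampling phase.* At time $t_0$ split $A$ into two parts with an independent fair coin per agent; call the part that contains $j$ $A_2$ and the other one $A_1$. Run $\mathrm{Indiv\_Alloc}(A_1,P(A_2),m/4)$ and $\mathrm{Indiv\_Alloc}(A_2,P(A_1),m/4)$. Each agent $i\in A_1$ (resp. $i \in A_2$) whose departure time is at least $t_0$ receives her $x_i$ items and pays $\tilde x_iP(A_2)$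 (resp. $\tilde x_iP(A_1)$); the other agents of $A$ receive and pay nothing. * *Revenue collection phase.* Set $m_1=m_2=m/4$. When an agent $i\in B$ arrives, toss a fair coin. On heads she joins $B_1$: let $(x',\tilde x')$ be the result of a fresh run of $\mathrm{Indiv\_Alloc}(A_1\cup\{i\},P(A_2\setminus\{j\}),m/4)$; she receives $x_i=\min\{x'_i,m_1\}$ items, pays $\min\{\tilde x'_i,m_1\}\cdot P(A_2\setminus\{j\})$, and $m_1$ is replaced by $m_1-x_i$. On tails she joins $B_2$ and the same is done with $\mathrm{Indiv\_Alloc}((A_2\cup\{i\})\setminus\{j\},P(A_1),m/4)$, the price $P(A_1)$, and $m_2$. **Theorem.** For every $\delta\in[0,1/3]$, with probability at least $$\Bigl(1-\frac1n\Bigr)\,\max\bigl\{0,\;1-2e^{-1/(32\varepsilon)}\bigr\}\,\max\bigl\{0,\;1-4e^{-\delta^2/(32\varepsilon)}\bigr\}$$ over the random matching and the coins that determine $A_1,A_2,B_1,B_2$, the expected revenue (total payment of all agents) of $\mathrm{Rev\_Indiv}(N,m)$, the expectation being taken over the random orders and lotteries inside the calls of $\mathrm{Indiv\_Alloc}$,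 is greater than $\dfrac{(1-3\delta)\,OPT^*}{64}$. -/

import Mathlib

namespace OnlineAuction

noncomputable section

/-! ### Discrete probability -/

/-- Probability of the event `E` under the discrete distribution `μ`, as a real number. -/
def prob {α : Type} (μ : PMF α) (E : Set α) : ℝ := (μ.toOuterMeasure E).toReal

/-- Expectation of `f` under `μ`. All the distributions below have finite support, so that the
sum has only finitely many nonzero terms. -/
def expect {α : Type} (μ : PMF α) (f : α → ℝ) : ℝ := ∑' a, (μ a).toReal * f a

/-- A coin that shows `true` with probability `q`. -/
def biasedCoin (q : ℝ) (h0 : 0 ≤ q) (h1 : q ≤ 1) : PMF Bool :=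
  PMF.ofFintype (fun c => if c then ENNReal.ofReal q else ENNReal.ofReal (1 - q)) (by
    simp only [Fintype.sum_bool, if_true, Bool.false_eq_true, if_false]
    rw [← ENNReal.ofReal_add h0 (by linarith)]
    simp)

/-! ### Benchmarks

Agent `i` has value `v i` for one item and budget `b i`. -/

section Benchmarks

variable {ι : Type} (v b : ι → ℝ)

/-- Revenue from selling at most `k` items to the agents of `S` at the uniform price `p`. -/
def uniformRevenue (S : Finset ι) (k p : ℝ) : ℝ :=
  min (∑ i ∈ S with p ≤ v i, b i / p) k * p

/-- `p` is a positive price that maximizes the uniform-price revenue. -/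
def IsOptimalPrice (S : Finset ι) (k p : ℝ) : Prop :=
  0 < p ∧ ∀ p' : ℝ, 0 < p' → uniformRevenue v b S k p' ≤ uniformRevenue v b S k p

/-- The optimal uniform-price revenue from selling at most `k` items to the agents of `S`. -/
def OPT (S : Finset ι) (k : ℝ) : ℝ :=
  sSup {r | ∃ p : ℝ, 0 < p ∧ r = uniformRevenue v b S k p}

/-- The optimal revenue from selling at most `k` items to the agents of `S` at heterogeneous
prices: agent `i` buys the (possibly fractional) quantity `x i` at a price `p i` per item that
does not exceed her value, and her total payment does not exceed her budget. -/
def OPTstar (S : Finset ι) (k : ℝ) : ℝ :=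
  sSup {r | ∃ p x : ι → ℝ, (∀ i ∈ S, 0 ≤ p i ∧ p i ≤ v i ∧ 0 ≤ x i ∧ x i * p i ≤ b i) ∧
    ∑ i ∈ S, x i ≤ k ∧ r = ∑ i ∈ S, x i * p i}

/-- The largest budget in `S`. -/
def maxBudget (S : Finset ι) : ℝ := sSup (b '' (S : Set ι))

/-- The market-size parameter `ε(S, k)`. -/
def marketEps (S : Finset ι) (k : ℝ) : ℝ := maxBudget b S / OPT v b S k

theorem uniformRevenue_eq (S : Finset ι) (k : ℝ) {p : ℝ} (hp : 0 < p) :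
    uniformRevenue v b S k p = min (∑ i ∈ S with p ≤ v i, b i) (k * p) := by
  rw [uniformRevenue, min_mul_of_nonneg _ _ hp.le, ← Finset.sum_div, div_mul_cancel₀ _ hp.ne']

/-- An optimal uniform price always exists. -/
theorem exists_isOptimalPrice (S : Finset ι) {k : ℝ} (hk : 0 ≤ k) :
    ∃ p, IsOptimalPrice v b S k p := by
  classical
  set M : ℝ := 1 + ∑ i ∈ S, |v i| with hM
  have hM0 : 0 < M := by
    have : 0 ≤ ∑ i ∈ S, |v i| := Finset.sum_nonneg fun i _ => abs_nonneg _
    linarith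
  have hMv : ∀ i ∈ S, v i < M := by
    intro i hi
    have h1 := Finset.single_le_sum (f := fun i => |v i|) (fun i _ => abs_nonneg _) hi
    have h2 := le_abs_self (v i)
    linarith
  let C : Finset ℝ := insert M ((S.filter fun i => 0 < v i).image v)
  have hC : C.Nonempty := ⟨M, Finset.mem_insert_self _ _⟩
  have hCpos : ∀ p ∈ C, 0 < p := by
    intro p hp
    rcases Finset.mem_insert.1 hp with rfl | hp
    · exact hM0
    · obtain ⟨i, hi, rfl⟩ := Finset.mem_image.1 hp
      exact (Finset.mem_filter.1 hi).2
  obtain ⟨p, hpC, hmax⟩ := C.exists_max_image (uniformRevenue v b S k) hC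
  refine ⟨p, hCpos p hpC, fun p' hp' => ?_⟩
  rcases (S.filter fun i => p' ≤ v i).eq_empty_or_nonempty with hT | hT
  · refine le_trans ?_ (hmax M (Finset.mem_insert_self _ _))
    have hTM : (S.filter fun i => M ≤ v i) = ∅ :=
      Finset.filter_eq_empty_iff.2 fun i hi => not_le.2 (hMv i hi)
    simp [uniformRevenue, hT, hTM, hk]
  · obtain ⟨i, hi, hmin⟩ := Finset.exists_min_image _ v hT
    have hi' := Finset.mem_filter.1 hi
    have hvi : 0 < v i := lt_of_lt_of_le hp' hi'.2
    refine le_trans ?_ (hmax (v i) (Finset.mem_insert_of_mem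
      (Finset.mem_image_of_mem v (Finset.mem_filter.2 ⟨hi'.1, hvi⟩))))
    have hTT : (S.filter fun l => v i ≤ v l) = S.filter fun l => p' ≤ v l := by
      ext l
      simp only [Finset.mem_filter]
      constructor
      · rintro ⟨h1, h2⟩
        exact ⟨h1, hi'.2.trans h2⟩
      · rintro ⟨h1, h2⟩
        exact ⟨h1, hmin l (Finset.mem_filter.2 ⟨h1, h2⟩)⟩
    rw [uniformRevenue_eq v b S k hp', uniformRevenue_eq v b S k hvi, hTT]
    exact min_le_min le_rfl (mul_le_mul_of_nonneg_left hi'.2 hk)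

end Benchmarks

/-! ### The allocation procedure for indivisible items -/

/-- State of the procedure: number of items left, items allocated, items charged for. -/
structure AllocState (ι : Type) where
  left : ℕ
  alloc : ι → ℕ
  charge : ι → ℝ

/-- A (randomized) allocation procedure: from a set of agents, a price per item and a number of
items to an allocation vector and a charging vector. -/
abbrev AllocProc (ι : Type) := Finset ι → ℝ → ℕ → PMF ((ι → ℕ) × (ι → ℝ))

section IndivAlloc

variable {ι : Type} [DecidableEq ι] (v b : ι → ℝ)

/-- One iteration of the procedure: agent `i` is processed at the price `p`. -/
def indivStep (p : ℝ) (s : AllocState ι) (i : ι) : PMF (AllocState ι) :=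
  if p ≤ v i then
    if (s.left : ℝ) ≤ b i / p then
      PMF.pure ⟨s.left - s.left, Function.update s.alloc i s.left,
        Function.update s.charge i s.left⟩
    else
      (biasedCoin (Int.fract (b i / p)) (Int.fract_nonneg _) (Int.fract_lt_one _).le).map
        fun up =>
          let x : ℕ := if up then ⌈b i / p⌉₊ else ⌊b i / p⌋₊
          ⟨s.left - x, Function.update s.alloc i x, Function.update s.charge i (b i / p)⟩
  else PMF.pure s

instance (S : Finset ι) : Nonempty (Fin S.card ≃ S) := ⟨S.equivFin.symm⟩

/-- The procedure `Indiv_Alloc(S, p, k)`: the agents of `S` are processed in a uniformly random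
order, with independent lotteries. -/
def indivAlloc : AllocProc ι := fun S p k =>
  (PMF.uniformOfFintype (Fin S.card ≃ S)).bind fun π =>
    ((List.ofFn fun l => (π l : ι)).foldlM (indivStep v b p)
      (⟨k, fun _ => 0, fun _ => 0⟩ : AllocState ι)).map fun s => (s.alloc, s.charge)

end IndivAlloc

/-! ### The online mechanism

An agent is identified with her (value, budget) pair `t : Fin n`. The agent `arr i` is the one
that arrives `i`-th; her time frame is `[a i, d i]`. -/

section Online

/-- The random choices that determine who arrives when and which set she is placed in:
the arrival order, the `n - 1` coins that determine the size of the sampling set (`true` is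
tails), and one coin per agent for the division of `A` and `B` into two parts. -/
structure Choices (n : ℕ) where
  arr : Equiv.Perm (Fin n)
  sizeCoin : Fin (n - 1) → Bool
  coin : Fin n → Bool

/-- The choices as a finite product. -/
def Choices.equivProd (n : ℕ) :
    Choices n ≃ Equiv.Perm (Fin n) × (Fin (n - 1) → Bool) × (Fin n → Bool) where
  toFun ω := (ω.arr, ω.sizeCoin, ω.coin)
  invFun t := ⟨t.1, t.2.1, t.2.2⟩
  left_inv _ := rfl
  right_inv _ := rfl

instance (n : ℕ) : Fintype (Choices n) := Fintype.ofEquiv _ (Choices.equivProd n).symm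

instance (n : ℕ) : Nonempty (Choices n) := ⟨⟨1, fun _ => false, fun _ => false⟩⟩

variable {n : ℕ}

/-- A uniformly random arrival order and independent fair coins. -/
def choicesDist (n : ℕ) : PMF (Choices n) := PMF.uniformOfFintype (Choices n)

variable [NeZero n] (ω : Choices n)

/-- The position (counted from `0`) of the last agent of the sampling set: the number of tails. -/
def Choices.pivotPos : Fin n :=
  ⟨(Finset.univ.filter fun l => ω.sizeCoin l = true).card, by
    have h := Finset.card_filter_le (Finset.univ : Finset (Fin (n - 1)))
      (fun l => ω.sizeCoin l = true)
    have hn : n ≠ 0 := NeZero.ne n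
    rw [Finset.card_univ, Fintype.card_fin] at h
    omega⟩

/-- The last agent `j` of the sampling set. -/
def Choices.pivot : Fin n := ω.arr ω.pivotPos

/-- The sampling set: the agents that arrive no later than `j`. -/
def Choices.A : Finset (Fin n) := Finset.univ.filter fun t => ω.arr.symm t ≤ ω.pivotPos

/-- The part of `A` that contains `j` is called `A₂`, the other one `A₁`. -/
def Choices.A₁ : Finset (Fin n) := ω.A.filter fun t => ω.coin t ≠ ω.coin ω.pivot

/-- The part of `A` that contains `j`. -/
def Choices.A₂ : Finset (Fin n) := ω.A.filter fun t => ω.coin t = ω.coin ω.pivot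

/-- The agents of `B`, in their order of arrival. -/
def Choices.arrivalsB : List (Fin n) :=
  ((List.finRange n).filter fun i => ω.pivotPos < i).map ω.arr

/-- Running outcome of the revenue collection phase: remaining items `m₁`, `m₂` of the two
halves, items received and payments made so far. -/
structure RunState (n : ℕ) where
  m₁ : ℕ
  m₂ : ℕ
  items : Fin n → ℕ
  pay : Fin n → ℝ

variable (P : Finset (Fin n) → ℝ) (alloc : AllocProc (Fin n)) (k : ℕ)

/-- Sampling phase with `k` items for each half; agents that departed before time `t₀`, the
arrival time of `j`, neither receive items nor pay. -/
def samplingPhase (a d : Fin n → ℝ) : PMF (RunState n) :=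
  (alloc ω.A₁ (P ω.A₂) k).bind fun y =>
    (alloc ω.A₂ (P ω.A₁) k).map fun z =>
      { m₁ := k
        m₂ := k
        items := fun t =>
          if a ω.pivotPos ≤ d (ω.arr.symm t) then
            if t ∈ ω.A₁ then y.1 t else if t ∈ ω.A₂ then z.1 t else 0
          else 0
        pay := fun t =>
          if a ω.pivotPos ≤ d (ω.arr.symm t) then
            if t ∈ ω.A₁ then y.2 t * P ω.A₂ else if t ∈ ω.A₂ then z.2 t * P ω.A₁ else 0
          else 0 }

/-- Arrival of an agent `t` of `B`: heads (`true`) places her in `B₁`, tails in `B₂`. -/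
def collectStep (s : RunState n) (t : Fin n) : PMF (RunState n) :=
  if ω.coin t then
    (alloc (insert t ω.A₁) (P (ω.A₂.erase ω.pivot)) k).map fun y =>
      { m₁ := s.m₁ - min (y.1 t) s.m₁
        m₂ := s.m₂
        items := Function.update s.items t (min (y.1 t) s.m₁)
        pay := Function.update s.pay t (min (y.2 t) (s.m₁ : ℝ) * P (ω.A₂.erase ω.pivot)) }
  else
    (alloc ((insert t ω.A₂).erase ω.pivot) (P ω.A₁) k).map fun y =>
      { m₁ := s.m₁
        m₂ := s.m₂ - min (y.1 t) s.m₂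
        items := Function.update s.items t (min (y.1 t) s.m₂)
        pay := Function.update s.pay t (min (y.2 t) (s.m₂ : ℝ) * P ω.A₁) }

/-- The mechanism `RS_Online(N, m, P, alloc)`, for truthful reports and given choices `ω`, as a
distribution over the internal randomness of the calls of `alloc`. -/
def rsOnline (m : ℕ) (a d : Fin n → ℝ) : PMF (RunState n) :=
  (samplingPhase ω P alloc (m / 4) a d).bind fun s =>
    ω.arrivalsB.foldlM (collectStep ω P alloc (m / 4)) s

/-- Expected revenue of `Rev_Indiv(N, m)` given the choices `ω`; the expectation is over the
random orders and lotteries of the calls of `Indiv_Alloc`. -/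
def revIndiv (v b : Fin n → ℝ) (m : ℕ) (a d : Fin n → ℝ) : ℝ :=
  expect (rsOnline ω P (indivAlloc v b) m a d) fun s => ∑ t, s.pay t

end Online

end

end OnlineAuction

open OnlineAuction

/-! Write O for OPT(N,m), β for the largest budget and k = m/4. Fix one side of the market: a
sampled part Q sets the price p = P(Q), the other sampled part K competes inside the allocation
runs, and H is the part of B that buys at p. The pivot j is left out of all three. The pivot is
uniform, and the other agents fall independently and uniformly into four classes, the two parts of
A∖{j} and the two parts of B (`card_label_eq_le`, `card_bad_le`).

If O ≥ 100β, three events, each failing with probability at most exp(-O/(144β)), together make the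
side earn more than O/64 (`lt_side_of_balanced`). (1) More than O/6 of weight O, spread over the
agents who can afford an optimal price for N, falls into Q. Then OPT(Q,k) ≥ O/6, so both kp and the
budget of Q at p are at least O/6. (2) Less than O/6 of a fractional segment of highest-value
agents, of total budget 5O/12, falls into Q. Then p is at most the cut-off value of this segment, so
the agents outside Q ∪ {j} have budget M ≥ O/4 - β at p. (3) More than M/6 of that budget falls into
H. Given Q its mean is M/3; the conditioning is needed because p depends on Q
(`card_labelClass_share`).

For the revenue, the random order inside a run gives a buyer, in expectation, at least the fraction
k/(2 max(D,k)) of her demand, where D is the demand of K (`le_sum_max_before`,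
`le_expect_charge_indivAlloc`). Since every buyer gets a fresh run, the expected payments form a
Riemann sum for the decreasing function (1 - x/k)₊ (`le_expect_foldlM_sum_pay`). Arithmetic on H, K
and M then gives O/64 (`lt_side_revenue`).

Both sides together earn more than O/32 with probability at least 1 - 6 exp(-O/(144β))
(`card_low_revenue_le`), and OPT* ≤ 2O (`OPTstar_le_two_mul_OPT`). The last factor of the claimed
bound is either zero, or it forces O > 216β and is itself at most this probability; the other two
factors are at most 1. -/

namespace OnlineAuction

/-! ### Expectations of finitely supported distributions and of sequential processes -/

section Expectation

variable {α β : Type}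

theorem expect_eq_sum {μ : PMF α} {s : Finset α} (h : ∀ a ∈ μ.support, a ∈ s) (f : α → ℝ) :
    expect μ f = ∑ a ∈ s, (μ a).toReal * f a := by
  refine tsum_eq_sum fun a ha => ?_
  have : μ a = 0 := by
    by_contra h0
    exact ha (h a ((PMF.mem_support_iff _ _).2 h0))
  simp [this]

theorem sum_toReal_eq_one {μ : PMF α} {s : Finset α} (h : ∀ a ∈ μ.support, a ∈ s) :
    ∑ a ∈ s, (μ a).toReal = 1 := by
  rw [← ENNReal.toReal_sum fun a _ => μ.apply_ne_top a]
  have : ∑ a ∈ s, μ a = ∑' a, μ a := by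
    refine (tsum_eq_sum fun a ha => ?_).symm
    by_contra h0
    exact ha (h a ((PMF.mem_support_iff _ _).2 h0))
  rw [this, μ.tsum_coe]
  rfl

theorem expect_pure (a : α) (f : α → ℝ) : expect (PMF.pure a) f = f a := by
  rw [expect_eq_sum (s := {a}) (by simp)]
  simp

theorem finite_support_pure (a : α) : (PMF.pure a).support.Finite := by simp

theorem finite_support_bind {μ : PMF α} {f : α → PMF β} (hμ : μ.support.Finite)
    (hf : ∀ a, (f a).support.Finite) : (μ.bind f).support.Finite := by
  rw [PMF.support_bind]
  exact hμ.biUnion fun a _ => hf a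

theorem finite_support_map {μ : PMF α} (f : α → β) (hμ : μ.support.Finite) :
    (μ.map f).support.Finite := by
  rw [PMF.support_map]
  exact hμ.image f

/-- Finite supports turn all infinite sums into finite ones, which can be exchanged; no summability
question remains. -/
theorem expect_bind {μ : PMF α} {f : α → PMF β} (hμ : μ.support.Finite)
    (hf : ∀ a, (f a).support.Finite) (g : β → ℝ) :
    expect (μ.bind f) g = expect μ fun a => expect (f a) g := by
  classical
  set s := hμ.toFinset with hs
  set t := s.biUnion fun a => (hf a).toFinset with ht
  have hμs : ∀ a ∈ μ.support, a ∈ s := fun a ha => by simpa [hs] using ha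
  have hft : ∀ a ∈ s, ∀ c ∈ (f a).support, c ∈ t := fun a ha c hc =>
    Finset.mem_biUnion.2 ⟨a, ha, by simpa using hc⟩
  have hbt : ∀ c ∈ (μ.bind f).support, c ∈ t := by
    intro c hc
    rw [PMF.support_bind] at hc
    obtain ⟨a, ha, hc⟩ := Set.mem_iUnion₂.1 hc
    exact hft a (hμs a ha) c hc
  rw [expect_eq_sum hbt, expect_eq_sum hμs]
  have h1 : ∀ c, ((μ.bind f) c).toReal = ∑ a ∈ s, (μ a).toReal * (f a c).toReal := by
    intro c
    rw [PMF.bind_apply, tsum_eq_sum (s := s), ENNReal.toReal_sum]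
    · simp
    · exact fun a _ => ENNReal.mul_ne_top (μ.apply_ne_top a) ((f a).apply_ne_top c)
    · intro a ha
      have : μ a = 0 := by
        by_contra h0
        exact ha (hμs a ((PMF.mem_support_iff _ _).2 h0))
      simp [this]
  simp only [h1, Finset.sum_mul]
  rw [Finset.sum_comm]
  refine Finset.sum_congr rfl fun a ha => ?_
  rw [expect_eq_sum (hft a ha), Finset.mul_sum]
  exact Finset.sum_congr rfl fun c _ => by ring

theorem expect_map {μ : PMF α} (hμ : μ.support.Finite) (f : α → β) (g : β → ℝ) :
    expect (μ.map f) g = expect μ fun a => g (f a) := by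
  rw [← PMF.bind_pure_comp, expect_bind (f := PMF.pure ∘ f) hμ fun a => finite_support_pure (f a)]
  simp [expect_pure]

theorem expect_mono {μ : PMF α} (hμ : μ.support.Finite) {f g : α → ℝ}
    (h : ∀ a ∈ μ.support, f a ≤ g a) : expect μ f ≤ expect μ g := by
  have hs : ∀ a ∈ μ.support, a ∈ hμ.toFinset := fun a ha => by simpa using ha
  rw [expect_eq_sum hs, expect_eq_sum hs]
  exact Finset.sum_le_sum fun a ha =>
    mul_le_mul_of_nonneg_left (h a (by simpa using ha)) ENNReal.toReal_nonneg

theorem expect_congr {μ : PMF α} (hμ : μ.support.Finite) {f g : α → ℝ}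
    (h : ∀ a ∈ μ.support, f a = g a) : expect μ f = expect μ g :=
  le_antisymm (expect_mono hμ fun a ha => (h a ha).le) (expect_mono hμ fun a ha => (h a ha).ge)

theorem expect_const {μ : PMF α} (hμ : μ.support.Finite) (c : ℝ) :
    expect μ (fun _ => c) = c := by
  have hs : ∀ a ∈ μ.support, a ∈ hμ.toFinset := fun a ha => by simpa using ha
  rw [expect_eq_sum hs, ← Finset.sum_mul, sum_toReal_eq_one hs, one_mul]

theorem expect_nonneg {μ : PMF α} (hμ : μ.support.Finite) {f : α → ℝ}
    (h : ∀ a ∈ μ.support, 0 ≤ f a) : 0 ≤ expect μ f :=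
  (expect_const hμ 0).symm.le.trans (expect_mono hμ h)

theorem le_expect {μ : PMF α} (hμ : μ.support.Finite) {f : α → ℝ} {c : ℝ}
    (h : ∀ a ∈ μ.support, c ≤ f a) : c ≤ expect μ f :=
  (expect_const hμ c).symm.le.trans (expect_mono hμ h)

theorem expect_add {μ : PMF α} (hμ : μ.support.Finite) (f g : α → ℝ) :
    expect μ (fun a => f a + g a) = expect μ f + expect μ g := by
  have hs : ∀ a ∈ μ.support, a ∈ hμ.toFinset := fun a ha => by simpa using ha
  simp only [expect_eq_sum hs, mul_add, Finset.sum_add_distrib]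

theorem expect_const_mul (μ : PMF α) (c : ℝ) (f : α → ℝ) :
    expect μ (fun a => c * f a) = c * expect μ f := by
  simp only [expect, ← tsum_mul_left]
  exact tsum_congr fun a => by ring

theorem expect_sub {μ : PMF α} (hμ : μ.support.Finite) (f g : α → ℝ) :
    expect μ (fun a => f a - g a) = expect μ f - expect μ g := by
  have hs : ∀ a ∈ μ.support, a ∈ hμ.toFinset := fun a ha => by simpa using ha
  simp only [expect_eq_sum hs, mul_sub, Finset.sum_sub_distrib]

theorem expect_uniformOfFintype [Fintype α] [Nonempty α] (f : α → ℝ) :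
    expect (PMF.uniformOfFintype α) f = (∑ a, f a) / Fintype.card α := by
  rw [expect_eq_sum (s := Finset.univ) (by simp)]
  simp [div_eq_inv_mul, Finset.mul_sum]

theorem finite_support_foldlM {σ : Type} {step : σ → β → PMF σ}
    (hstep : ∀ s t, (step s t).support.Finite) (l : List β) (s : σ) :
    (l.foldlM step s).support.Finite := by
  induction l generalizing s with
  | nil => exact finite_support_pure s
  | cons t l ih =>
    rw [List.foldlM_cons]
    exact finite_support_bind (hstep s t) ih

theorem mem_support_foldlM {σ : Type} {step : σ → β → PMF σ} {I : σ → Prop}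
    (hI : ∀ s t, I s → ∀ s' ∈ (step s t).support, I s') (l : List β) {s : σ} (hs : I s) :
    ∀ s' ∈ (l.foldlM step s).support, I s' := by
  induction l generalizing s with
  | nil =>
    intro s' hs'
    have : s' = s := by simpa using (PMF.mem_support_pure_iff s s').1 hs'
    exact this ▸ hs
  | cons t l ih =>
    intro s' hs'
    rw [List.foldlM_cons] at hs'
    obtain ⟨s₁, h1, h2⟩ := (PMF.mem_support_bind_iff _ _ _).1 hs'
    exact ih (hI s t hs s₁ h1) s' h2

theorem expect_foldlM_append {σ : Type} {step : σ → β → PMF σ}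
    (hstep : ∀ s t, (step s t).support.Finite) (l l' : List β) (s : σ) (g : σ → ℝ) :
    expect ((l ++ l').foldlM step s) g =
      expect (l.foldlM step s) fun s' => expect (l'.foldlM step s') g := by
  rw [List.foldlM_append]
  exact expect_bind (finite_support_foldlM hstep l s) (finite_support_foldlM hstep l') g

theorem expect_foldlM_cons {σ : Type} {step : σ → β → PMF σ}
    (hstep : ∀ s t, (step s t).support.Finite) (t : β) (l : List β) (s : σ) (g : σ → ℝ) :
    expect ((t :: l).foldlM step s) g =
      expect (step s t) fun s' => expect (l.foldlM step s') g := by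
  rw [List.foldlM_cons]
  exact expect_bind (hstep s t) (finite_support_foldlM hstep l) g

theorem expect_foldlM_singleton {σ : Type} {step : σ → β → PMF σ}
    (hstep : ∀ s t, (step s t).support.Finite) (t : β) (s : σ) (g : σ → ℝ) :
    expect ([t].foldlM step s) g = expect (step s t) g := by
  rw [expect_foldlM_cons hstep]
  congr 1
  funext s'
  exact expect_pure s' g

/-- A quantity that drops by at most `y t` in expectation when `t` is processed drops by at most
the sum of these amounts in a fold. -/
theorem sub_sum_le_expect_foldlM {σ : Type} {step : σ → β → PMF σ} {I : σ → Prop} {f : σ → ℝ}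
    {y : β → ℝ} (hstep : ∀ s t, (step s t).support.Finite)
    (hI : ∀ s t, I s → ∀ s' ∈ (step s t).support, I s')
    (l : List β) (hf : ∀ s, ∀ t ∈ l, I s → f s - y t ≤ expect (step s t) f) {s : σ} (hs : I s) :
    f s - (l.map y).sum ≤ expect (l.foldlM step s) f := by
  induction l generalizing s with
  | nil =>
    rw [List.map_nil, List.sum_nil, sub_zero]
    exact (expect_pure s f).ge
  | cons t l ih =>
    rw [expect_foldlM_cons hstep, List.map_cons, List.sum_cons]
    calc f s - (y t + (l.map y).sum) ≤ expect (step s t) f - (l.map y).sum := by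
          linarith [hf s t List.mem_cons_self hs]
      _ = expect (step s t) fun s' => f s' - (l.map y).sum := by
          rw [expect_sub (hstep s t), expect_const (hstep s t)]
      _ ≤ _ := expect_mono (hstep s t) fun s' hs' =>
          ih (fun s u hu => hf s u (List.mem_cons_of_mem _ hu)) (hI s t hs s' hs')

/-- A quantity that is not affected by the processing of the elements of `l`. -/
theorem expect_foldlM_eq_self {σ : Type} {step : σ → β → PMF σ} {f : σ → ℝ}
    (hstep : ∀ s t, (step s t).support.Finite) (l : List β)
    (hf : ∀ t ∈ l, ∀ s, ∀ s' ∈ (step s t).support, f s' = f s) (s : σ) :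
    expect (l.foldlM step s) f = f s := by
  induction l generalizing s with
  | nil => exact expect_pure s f
  | cons t l ih =>
    rw [expect_foldlM_cons hstep]
    rw [expect_congr (hstep s t) (g := fun _ => f s), expect_const (hstep s t)]
    intro s' hs'
    rw [ih (fun u hu => hf u (List.mem_cons_of_mem _ hu)), hf t List.mem_cons_self s s' hs']

/-- Revenue of a sequential sale of `k` items: buyer `t` takes `y t` items in expectation and
pays at least `p * y t` in expectation, scaled by the fraction of items left. -/
theorem le_expect_foldlM_sum_pay [DecidableEq β] {σ : Type} {step : σ → β → PMF σ} {I : σ → Prop}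
    {f : σ → ℝ} {pay : σ → β → ℝ} {y : β → ℝ} {k p : ℝ} (hk : 0 < k) (hp : 0 ≤ p)
    (hstep : ∀ s t, (step s t).support.Finite)
    (hI : ∀ s t, I s → ∀ s' ∈ (step s t).support, I s')
    (hI0 : ∀ s, I s → 0 ≤ f s)
    (hy : ∀ t, 0 ≤ y t)
    (hpay' : ∀ s t u, u ≠ t → ∀ s' ∈ (step s t).support, pay s' u = pay s u)
    (l : List β) (hl : l.Nodup)
    (hf : ∀ s, ∀ t ∈ l, I s → f s - y t ≤ expect (step s t) f)
    (hpay : ∀ s, ∀ t ∈ l, I s → p * (y t * (f s / k)) ≤ expect (step s t) fun s' => pay s' t)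
    {s : σ} (hs : I s) (hfs : f s = k) :
    p * (k / 2 * (1 - max 0 (1 - (l.map y).sum / k) ^ 2)) ≤
      expect (l.foldlM step s) fun s' => ∑ t ∈ l.toFinset, pay s' t := by
  -- Buyers are added at the end of the list, because what the last buyer pays depends on the
  -- expected number of items left by all the earlier ones.
  induction l using List.reverseRecOn with
  | nil =>
    simp only [List.map_nil, List.sum_nil, zero_div, sub_zero, zero_le_one, sup_of_le_right,
      one_pow, sub_self, mul_zero, List.toFinset_nil, Finset.sum_empty]
    rw [expect_const (finite_support_foldlM hstep _ _)]
  | append_singleton l t ih =>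
    have hl' : l.Nodup := (List.nodup_append.1 hl).1
    have htl : t ∉ l := fun h => (List.disjoint_of_nodup_append hl) h (by simp)
    have hfin := finite_support_foldlM hstep l s
    rw [expect_foldlM_append hstep]
    have e1 : (l ++ [t]).toFinset = insert t l.toFinset := by
      ext u; simp
    have e2 : ∀ s', expect ([t].foldlM step s') (fun s' => ∑ u ∈ (l ++ [t]).toFinset, pay s' u)
        = expect (step s' t) (fun s'' => pay s'' t) + ∑ u ∈ l.toFinset, pay s' u := by
      intro s'
      rw [expect_foldlM_singleton hstep, e1]
      simp only [Finset.sum_insert (show t ∉ l.toFinset by simpa using htl)]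
      rw [expect_add (hstep s' t)]
      congr 1
      rw [expect_congr (hstep s' t) (g := fun _ => ∑ u ∈ l.toFinset, pay s' u),
        expect_const (hstep s' t)]
      intro s'' hs''
      refine Finset.sum_congr rfl fun u hu => hpay' s' t u ?_ s'' hs''
      rintro rfl
      exact htl (by simpa using hu)
    simp only [e2]
    rw [expect_add hfin]
    have ih' := ih hl' (fun s u hu => hf s u (List.mem_append_left _ hu))
      (fun s u hu => hpay s u (List.mem_append_left _ hu))
    set S := (l.map y).sum with hS
    have h1 : k - S ≤ expect (l.foldlM step s) f :=
      hfs ▸ sub_sum_le_expect_foldlM hstep hI l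
      (fun s u hu => hf s u (List.mem_append_left _ hu)) hs
    have h2 : 0 ≤ expect (l.foldlM step s) f :=
      expect_nonneg hfin fun s' hs' => hI0 s' (mem_support_foldlM hI l hs s' hs')
    -- The payment bound is linear in the number of items left, so only the mean of that number
    -- matters.
    have h3 : p * (y t * max 0 (1 - S / k)) ≤
        expect (l.foldlM step s) fun s' => expect (step s' t) fun s'' => pay s'' t := by
      calc p * (y t * max 0 (1 - S / k))
          ≤ p * (y t * (expect (l.foldlM step s) f / k)) := by
            refine mul_le_mul_of_nonneg_left (mul_le_mul_of_nonneg_left ?_ (hy t)) hp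
            refine max_le (div_nonneg h2 hk.le) ?_
            rw [le_div_iff₀ hk, sub_mul, div_mul_cancel₀ _ hk.ne']
            linarith
        _ = expect (l.foldlM step s) fun s' => p * y t / k * f s' := by
            rw [expect_const_mul]; ring
        _ ≤ _ := expect_mono hfin fun s' hs' => by
            have := hpay s' t (by simp) (mem_support_foldlM hI l hs s' hs')
            calc _ = p * (y t * (f s' / k)) := by ring
              _ ≤ _ := this
    rw [List.map_append, List.sum_append, ← hS]
    simp only [List.map_cons, List.map_nil, List.sum_cons, List.sum_nil, add_zero]
    set c := max 0 (1 - (S + y t) / k) with hc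
    set a := max 0 (1 - S / k) with ha
    have hca : c ≤ a := max_le_max le_rfl (by
      have := div_nonneg (hy t) hk.le
      rw [add_div]; linarith)
    have hac : k * (a - c) ≤ y t := by
      have : a ≤ c + y t / k := by
        refine max_le (add_nonneg (le_max_left _ _) (div_nonneg (hy t) hk.le)) ?_
        have := le_max_right 0 (1 - (S + y t) / k)
        rw [add_div] at this
        rw [hc, add_div]; linarith
      have h5 : k * (y t / k) = y t := by field_simp
      nlinarith
    have hc0 : 0 ≤ c := le_max_left _ _
    -- The new term y·a dominates the integral of the decreasing function (1 - x/k)₊ over an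
    -- interval of length y, which is k(a² - c²)/2.
    have key : k / 2 * (1 - c ^ 2) ≤ k / 2 * (1 - a ^ 2) + y t * a := by
      nlinarith [mul_le_mul_of_nonneg_right hac (by linarith : 0 ≤ a + c),
        mul_nonneg (hy t) (sub_nonneg.2 hca)]
    calc p * (k / 2 * (1 - c ^ 2)) ≤ p * (k / 2 * (1 - a ^ 2) + y t * a) :=
          mul_le_mul_of_nonneg_left key hp
      _ ≤ _ := by rw [mul_add]; linarith

end Expectation

/-! ### The allocation procedure in a fixed order -/

section IndivAllocAnalysis

theorem expect_biasedCoin (q : ℝ) (h0 : 0 ≤ q) (h1 : q ≤ 1) (f : Bool → ℝ) :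
    expect (biasedCoin q h0 h1) f = q * f true + (1 - q) * f false := by
  rw [expect_eq_sum (s := Finset.univ) (by simp)]
  simp [biasedCoin, ENNReal.toReal_ofReal, h0, h1]

variable {ι : Type} (v b : ι → ℝ)

/-- The (fractional) demand of agent `i` at price `p`. -/
noncomputable def demand (p : ℝ) (i : ι) : ℝ := if p ≤ v i then b i / p else 0

theorem demand_nonneg (hb : ∀ i, 0 ≤ b i) {p : ℝ} (hp : 0 < p) (i : ι) : 0 ≤ demand v b p i := by
  unfold demand
  split_ifs
  · exact div_nonneg (hb i) hp.le
  · exact le_rfl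

/-- Invariant of the allocation procedure started with `k` items. -/
def AllocState.Inv (k : ℕ) (s : AllocState ι) : Prop :=
  s.left ≤ k ∧ ∀ i, 0 ≤ s.charge i ∧ s.charge i ≤ k

/-- The initial state of the allocation procedure. -/
def AllocState.init (k : ℕ) : AllocState ι := ⟨k, fun _ => 0, fun _ => 0⟩

theorem AllocState.init_inv (k : ℕ) : (AllocState.init k : AllocState ι).Inv k :=
  ⟨le_rfl, fun _ => ⟨le_rfl, Nat.cast_nonneg k⟩⟩

variable [DecidableEq ι]

theorem finite_support_indivStep (p : ℝ) (s : AllocState ι) (i : ι) :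
    (indivStep v b p s i).support.Finite := by
  unfold indivStep
  split_ifs
  · exact finite_support_pure _
  · exact finite_support_map _ (Set.toFinite _)
  · exact finite_support_pure _

theorem finite_support_indivAlloc (S : Finset ι) (p : ℝ) (k : ℕ) :
    (indivAlloc v b S p k).support.Finite :=
  finite_support_bind (Set.toFinite _) fun _ =>
    finite_support_map _ (finite_support_foldlM (finite_support_indivStep v b p) _ _)

/-- In one step, the states reached: items of other agents are not touched. -/
theorem indivStep_other {p : ℝ} {s s' : AllocState ι} {i u : ι} (hu : u ≠ i)
    (hs' : s' ∈ (indivStep v b p s i).support) :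
    s'.alloc u = s.alloc u ∧ s'.charge u = s.charge u := by
  unfold indivStep at hs'
  split_ifs at hs'
  · rw [PMF.mem_support_pure_iff] at hs'
    simp [hs', hu]
  · rw [PMF.mem_support_map_iff] at hs'
    obtain ⟨c, -, rfl⟩ := hs'
    simp [hu]
  · rw [PMF.mem_support_pure_iff] at hs'
    simp [hs']

theorem indivStep_inv (hb : ∀ i, 0 ≤ b i) {p : ℝ} (hp : 0 < p) (k : ℕ) (s : AllocState ι) (i : ι)
    (hs : s.Inv k) : ∀ s' ∈ (indivStep v b p s i).support, s'.Inv k := by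
  intro s' hs'
  unfold indivStep at hs'
  split_ifs at hs' with h1 h2
  · rw [PMF.mem_support_pure_iff] at hs'
    subst hs'
    refine ⟨by simp, fun u => ?_⟩
    rcases eq_or_ne u i with rfl | hu
    · simpa using hs.1
    · simpa [hu] using hs.2 u
  · rw [PMF.mem_support_map_iff] at hs'
    obtain ⟨c, -, rfl⟩ := hs'
    refine ⟨(Nat.sub_le _ _).trans hs.1, fun u => ?_⟩
    rcases eq_or_ne u i with rfl | hu
    · simp only [Function.update_self]
      refine ⟨div_nonneg (hb u) hp.le, (not_le.1 h2).le.trans ?_⟩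
      exact_mod_cast hs.1
    · simpa [hu] using hs.2 u
  · rw [PMF.mem_support_pure_iff] at hs'
    exact hs' ▸ hs

theorem fract_mul_ceil_add {x : ℝ} (hx : 0 ≤ x) :
    Int.fract x * (⌈x⌉₊ : ℝ) + (1 - Int.fract x) * (⌊x⌋₊ : ℝ) = x := by
  have h1 : (⌊x⌋₊ : ℝ) = x - Int.fract x := by
    rw [natCast_floor_eq_intCast_floor hx]
    exact (Int.self_sub_fract x).symm
  rcases eq_or_ne (Int.fract x) 0 with h | h
  · rw [h1, h]; ring
  · have h2 : (⌈x⌉₊ : ℝ) = x + 1 - Int.fract x := by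
      rw [natCast_ceil_eq_intCast_ceil hx]
      exact Int.ceil_eq_add_one_sub_fract h
    rw [h1, h2]; ring

/-- Randomized rounding has the demand as its mean, and truncation of the subtraction at zero can
only leave more items. -/
theorem sub_demand_le_expect_left (hb : ∀ i, 0 ≤ b i) {p : ℝ} (hp : 0 < p) (s : AllocState ι)
    (i : ι) : (s.left : ℝ) - demand v b p i ≤ expect (indivStep v b p s i) fun s' => s'.left := by
  unfold indivStep demand
  split_ifs with h1 h2
  · rw [expect_pure]
    simpa using h2
  · rw [expect_map (Set.toFinite _), expect_biasedCoin]
    have h0 := div_nonneg (hb i) hp.le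
    have e := fract_mul_ceil_add h0
    have f0 := Int.fract_nonneg (b i / p)
    have f1 := (Int.fract_lt_one (b i / p)).le
    have g (x : ℕ) : (s.left : ℝ) - x ≤ ((s.left - x : ℕ) : ℝ) := by
      rw [sub_le_iff_le_add]
      exact_mod_cast le_tsub_add
    have h3 := mul_le_mul_of_nonneg_left (g ⌈b i / p⌉₊) f0
    have h4 := mul_le_mul_of_nonneg_left (g ⌊b i / p⌋₊) (sub_nonneg.2 f1)
    simp only [if_true, Bool.false_eq_true, if_false]
    linarith
  · rw [expect_pure]
    simp

/-- The lottery is fair. -/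
theorem expect_alloc_eq_expect_charge_indivStep (hb : ∀ i, 0 ≤ b i) {p : ℝ} (hp : 0 < p)
    (s : AllocState ι) (i : ι) (hs : (s.alloc i : ℝ) = s.charge i) :
    expect (indivStep v b p s i) (fun s' => (s'.alloc i : ℝ)) =
      expect (indivStep v b p s i) fun s' => s'.charge i := by
  unfold indivStep
  split_ifs with h1 h2
  · simp [expect_pure]
  · rw [expect_map (Set.toFinite _), expect_biasedCoin, expect_map (Set.toFinite _),
      expect_biasedCoin]
    have e := fract_mul_ceil_add (div_nonneg (hb i) hp.le)
    simp only [Function.update_self, if_true, Bool.false_eq_true, if_false]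
    linarith
  · simpa [expect_pure] using hs

/-- With demand x ≤ k and l ≤ k items left, the charge min(x, l) is at least x·l/k. This form is
linear in l, hence compatible with taking expectations. -/
theorem demand_mul_le_expect_charge {p : ℝ} {k : ℕ} (hk : 0 < k) (s : AllocState ι) (i : ι)
    (hi : demand v b p i ≤ k) (hi0 : 0 ≤ demand v b p i) (hs : s.Inv k) :
    demand v b p i * (s.left / k) ≤ expect (indivStep v b p s i) fun s' => s'.charge i := by
  have hk' : (0 : ℝ) < k := by exact_mod_cast hk
  have hl : (s.left : ℝ) ≤ k := by exact_mod_cast hs.1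
  have hl1 : (s.left : ℝ) / k ≤ 1 := (div_le_one hk').2 hl
  have hl0 : 0 ≤ (s.left : ℝ) / k := by positivity
  unfold indivStep
  split_ifs with h1 h2
  · rw [expect_pure]
    simp only [Function.update_self]
    calc demand v b p i * (s.left / k) ≤ k * (s.left / k) := by gcongr
      _ = s.left := by field_simp
  · rw [expect_map (Set.toFinite _), expect_biasedCoin]
    simp only [Function.update_self, demand, if_pos h1] at hi0 ⊢
    nlinarith
  · rw [expect_pure, demand, if_neg h1, zero_mul]
    exact (hs.2 i).1

section FixedOrder

variable {p : ℝ} {k : ℕ} {l₁ l₂ : List ι} {i : ι}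

/-- The outcome for `i` is decided when `i` is processed. -/
theorem expect_foldlM_indivStep_split (h2 : i ∉ l₂) (s : AllocState ι) (g : ℕ → ℝ → ℝ) :
    expect ((l₁ ++ i :: l₂).foldlM (indivStep v b p) s) (fun s' => g (s'.alloc i) (s'.charge i)) =
      expect (l₁.foldlM (indivStep v b p) s) fun s' =>
        expect (indivStep v b p s' i) fun s'' => g (s''.alloc i) (s''.charge i) := by
  have hstep := finite_support_indivStep v b p
  rw [expect_foldlM_append hstep]
  congr 1
  funext s'
  rw [expect_foldlM_cons hstep]
  congr 1
  funext s''
  refine expect_foldlM_eq_self (f := fun s' => g (s'.alloc i) (s'.charge i)) hstep l₂ ?_ s''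
  intro t ht s₁ s₂ hs₂
  obtain ⟨e1, e2⟩ := indivStep_other v b (u := i) (fun h => h2 (h ▸ ht)) hs₂
  simp [e1, e2]

theorem expect_alloc_eq_expect_charge_foldlM (hb : ∀ i, 0 ≤ b i) (hp : 0 < p) (h1 : i ∉ l₁)
    (h2 : i ∉ l₂) :
    expect ((l₁ ++ i :: l₂).foldlM (indivStep v b p) (AllocState.init k))
        (fun s' => (s'.alloc i : ℝ)) =
      expect ((l₁ ++ i :: l₂).foldlM (indivStep v b p) (AllocState.init k))
        fun s' => s'.charge i := by
  rw [expect_foldlM_indivStep_split v b h2 _ fun x _ => (x : ℝ),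
    expect_foldlM_indivStep_split v b h2 _ fun _ y => y]
  have hstep := finite_support_indivStep v b p
  refine expect_congr (finite_support_foldlM hstep _ _) fun s hs =>
    expect_alloc_eq_expect_charge_indivStep v b hb hp s i ?_
  clear h2
  have : ∀ (l : List ι), i ∉ l → ∀ s₀ : AllocState ι, (s₀.alloc i : ℝ) = s₀.charge i →
      ∀ s ∈ (l.foldlM (indivStep v b p) s₀).support, (s.alloc i : ℝ) = s.charge i := by
    intro l
    induction l with
    | nil =>
      intro _ s₀ h s hs
      rw [(PMF.mem_support_pure_iff s₀ s).1 hs]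
      exact h
    | cons t l ih =>
      intro hi s₀ h s hs
      rw [List.foldlM_cons] at hs
      obtain ⟨s₁, h3, h4⟩ := (PMF.mem_support_bind_iff _ _ _).1 hs
      obtain ⟨e1, e2⟩ := indivStep_other v b (u := i) (fun h => hi (h ▸ List.mem_cons_self)) h3
      exact ih (fun h => hi (List.mem_cons_of_mem _ h)) s₁ (by rw [e1, e2, h]) s h4
  exact this l₁ h1 _ (by simp [AllocState.init]) s hs

/-- Combines the linear bound on the charge with the mean number of items that the agents before `i`
leave. -/
theorem le_expect_charge_foldlM (hb : ∀ i, 0 ≤ b i) (hp : 0 < p) (hk : 0 < k) (h2 : i ∉ l₂)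
    (hi : demand v b p i ≤ k) :
    demand v b p i * max 0 (1 - (l₁.map (demand v b p)).sum / k) ≤
      expect ((l₁ ++ i :: l₂).foldlM (indivStep v b p) (AllocState.init k))
        fun s' => s'.charge i := by
  have hk' : (0 : ℝ) < k := by exact_mod_cast hk
  rw [expect_foldlM_indivStep_split v b h2 _ fun _ y => y]
  have hstep := finite_support_indivStep v b p
  have hinv : ∀ s ∈ (l₁.foldlM (indivStep v b p) (AllocState.init k)).support, s.Inv k :=
    mem_support_foldlM (fun s t hs => indivStep_inv v b hb hp k s t hs) l₁
      (AllocState.init_inv k)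
  have hfin := finite_support_foldlM hstep l₁ (AllocState.init k)
  have hd := demand_nonneg v b hb hp i
  have hleft := sub_sum_le_expect_foldlM (I := fun _ => True) (f := fun s => (s.left : ℝ)) hstep
    (fun _ _ _ _ _ => trivial) l₁ (fun s t _ _ => sub_demand_le_expect_left v b hb hp s t)
    (s := AllocState.init k) trivial
  have h0 : 0 ≤ expect (l₁.foldlM (indivStep v b p) (AllocState.init k)) fun s => (s.left : ℝ) :=
    expect_nonneg hfin fun s _ => Nat.cast_nonneg _
  simp only [AllocState.init] at hleft h0 hfin hinv ⊢
  calc demand v b p i * max 0 (1 - (l₁.map (demand v b p)).sum / k)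
      ≤ demand v b p i * (expect (l₁.foldlM (indivStep v b p) ⟨k, fun _ => 0, fun _ => 0⟩)
          (fun s => (s.left : ℝ)) / k) := by
        refine mul_le_mul_of_nonneg_left (max_le (div_nonneg h0 hk'.le) ?_) hd
        rw [le_div_iff₀ hk', sub_mul, div_mul_cancel₀ _ hk'.ne']
        linarith
    _ = expect (l₁.foldlM (indivStep v b p) ⟨k, fun _ => 0, fun _ => 0⟩)
          fun s => demand v b p i / k * (s.left : ℝ) := by
        rw [expect_const_mul]; ring
    _ ≤ _ := expect_mono hfin fun s hs => by
        refine le_trans (le_of_eq ?_) (demand_mul_le_expect_charge v b hk s i hi hd (hinv s hs))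
        ring

end FixedOrder

end IndivAllocAnalysis

/-! ### The load before a given element in a uniformly random order -/

section RandomOrder

/-- The trapezoidal rule overestimates the integral of the convex function (1 - x)₊. The term with
factor ρ corrects the endpoint weights, and the induction telescopes. -/
theorem le_sum_max_sub_mul {ρ : ℝ} (hρ : 0 ≤ ρ) (N : ℕ) :
    1 - max 0 (1 - N * ρ) ^ 2 + ρ * (1 - max 0 (1 - N * ρ)) ≤
      2 * ρ * ∑ r ∈ Finset.range N, max 0 (1 - r * ρ) := by
  induction N with
  | zero => simp
  | succ N ih =>
    rw [Finset.sum_range_succ, mul_add]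
    set a := max 0 (1 - N * ρ)
    set c := max 0 (1 - ((N + 1 : ℕ) : ℝ) * ρ) with hc
    have ha0 : 0 ≤ a := le_max_left _ _
    have hc0 : 0 ≤ c := le_max_left _ _
    have hac : a ≤ c + ρ := by
      refine max_le (by positivity) ?_
      have := le_max_right 0 (1 - ((N + 1 : ℕ) : ℝ) * ρ)
      rw [← hc] at this
      push_cast at this
      linarith
    nlinarith [mul_le_mul_of_nonneg_right hac (add_nonneg ha0 hc0)]

variable {α : Type} [Fintype α] [DecidableEq α] {s : ℕ}

/-- Swapping the positions `t` and `t'` preserves the condition at `r`: given the position of `i`,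
the others are exchangeable. -/
theorem sum_equiv_apply_eq (β : α → ℝ) (i : α) {r t t' : Fin s} (ht : t ≠ r) (ht' : t' ≠ r) :
    ∑ π : Fin s ≃ α with π r = i, β (π t) = ∑ π : Fin s ≃ α with π r = i, β (π t') := by
  refine Finset.sum_equiv ((Equiv.swap t t').equivCongr (Equiv.refl α)) ?_ ?_
  · intro π
    simp [Equiv.swap_apply_of_ne_of_ne ht.symm ht'.symm]
  · intro π _
    simp

theorem card_equiv_apply_eq (i : α) (r r' : Fin s) :
    (Finset.univ.filter fun π : Fin s ≃ α => π r = i).card =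
      (Finset.univ.filter fun π : Fin s ≃ α => π r' = i).card := by
  refine Finset.card_equiv ((Equiv.swap r r').equivCongr (Equiv.refl α)) ?_
  intro π
  simp

theorem sum_erase_equiv (β : α → ℝ) (π : Fin s ≃ α) (r : Fin s) :
    ∑ t ∈ Finset.univ.erase r, β (π t) = ∑ a ∈ Finset.univ.erase (π r), β a := by
  refine Finset.sum_equiv π ?_ fun _ _ => rfl
  intro t
  simp

/-- In a uniformly random order the total size of the elements before `i` is at most a random
fraction of the total size of the other elements. -/
theorem le_sum_max_before (β : α → ℝ) (hβ : ∀ a, 0 ≤ β a) (i : α) {k : ℝ} (hk : 0 < k)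
    (hs : 0 < s) :
    (Fintype.card (Fin s ≃ α) : ℝ) * (k / (2 * max (∑ a ∈ Finset.univ.erase i, β a) k)) ≤
      ∑ π : Fin s ≃ α, max 0 (1 - (∑ t with t < π.symm i, β (π t)) / k) := by
  set D := ∑ a ∈ Finset.univ.erase i, β a with hD
  -- Enlarging the load to at least k makes (1 - rρ)₊ vanish at r = s below, which gives the sum
  -- over positions a clean lower bound.
  set G := max D k with hG
  have hD0 : 0 ≤ D := Finset.sum_nonneg fun a _ => hβ a
  have hG0 : 0 < G := hk.trans_le (le_max_right _ _)
  let r₀ : Fin s := ⟨0, hs⟩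
  set F : ℝ := ((Finset.univ.filter fun π : Fin s ≃ α => π r₀ = i).card : ℝ) with hF
  have hF0 : 0 ≤ F := Nat.cast_nonneg _
  have hFr : ∀ r, ((Finset.univ.filter fun π : Fin s ≃ α => π r = i).card : ℝ) = F := fun r => by
    rw [hF, card_equiv_apply_eq i r r₀]
  have fib : ∀ f : (Fin s ≃ α) → ℝ, ∑ π, f π = ∑ r, ∑ π : Fin s ≃ α with π r = i, f π := by
    intro f
    rw [← Finset.sum_fiberwise (s := Finset.univ) (g := fun π : Fin s ≃ α => π.symm i)]
    refine Finset.sum_congr rfl fun r _ => Finset.sum_congr ?_ fun _ _ => rfl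
    ext π
    simp only [Finset.mem_filter, Finset.mem_univ, true_and]
    rw [Equiv.symm_apply_eq, eq_comm]
  have hcard : (Fintype.card (Fin s ≃ α) : ℝ) = s * F := by
    have := fib fun _ => 1
    simp only [Finset.sum_const, nsmul_eq_mul, mul_one, hFr] at this
    simpa using this
  -- Given that `i` sits at `r`, each other position carries D/(s - 1) on average; the product form
  -- avoids division when s = 1.
  have hbef : ∀ r t : Fin s, t ≠ r → ((s : ℝ) - 1) * ∑ π : Fin s ≃ α with π r = i, β (π t)
      = F * D := by
    intro r t ht
    have h1 : ∑ t' ∈ Finset.univ.erase r, ∑ π : Fin s ≃ α with π r = i, β (π t') = F * D := by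
      rw [Finset.sum_comm, ← hFr r, ← nsmul_eq_mul, ← Finset.sum_const]
      refine Finset.sum_congr rfl fun π hπ => ?_
      rw [sum_erase_equiv, (Finset.mem_filter.1 hπ).2]
    rw [← h1, Finset.sum_congr rfl fun t' ht' =>
      sum_equiv_apply_eq β i (Finset.ne_of_mem_erase ht') ht, Finset.sum_const, nsmul_eq_mul,
      Finset.card_erase_of_mem (Finset.mem_univ _), Finset.card_univ, Fintype.card_fin,
      Nat.cast_sub hs, Nat.cast_one]
  -- The mean relative load per position. For s = 1 the denominator vanishes and ρ = 0, so that case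
  -- is split off below.
  set ρ : ℝ := G / ((s - 1) * k) with hρ
  have hs1 : (1 : ℝ) ≤ s := by exact_mod_cast hs
  have hρ0 : 0 ≤ ρ := div_nonneg hG0.le (mul_nonneg (by linarith) hk.le)
  -- Jensen's inequality for the positive part, conditionally on `i` having position `r`.
  have hr : ∀ r : Fin s, F * max 0 (1 - (r : ℕ) * ρ) ≤ ∑ π : Fin s ≃ α with π r = i,
      max 0 (1 - (∑ t with t < π.symm i, β (π t)) / k) := by
    intro r
    have e1 : ∀ π ∈ Finset.univ.filter fun π : Fin s ≃ α => π r = i, π.symm i = r := by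
      intro π hπ
      rw [Equiv.symm_apply_eq, (Finset.mem_filter.1 hπ).2]
    rw [mul_max_of_nonneg _ _ hF0, mul_zero]
    refine max_le (Finset.sum_nonneg fun _ _ => le_max_left _ _) ?_
    calc F * (1 - (r : ℕ) * ρ)
        ≤ ∑ π : Fin s ≃ α with π r = i, (1 - (∑ t with t < r, β (π t)) / k) := by
          rw [Finset.sum_sub_distrib, Finset.sum_const, nsmul_eq_mul, hFr, mul_one,
            ← Finset.sum_div, Finset.sum_comm, mul_sub, mul_one]
          refine sub_le_sub_left ?_ _
          rw [div_le_iff₀ hk]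
          rcases hs1.eq_or_lt with h | h
          · have : (Finset.univ.filter fun t : Fin s => t < r) = ∅ := by
              refine Finset.filter_eq_empty_iff.2 fun t _ => ?_
              have h' : s = 1 := by exact_mod_cast h.symm
              subst h'
              simp [Subsingleton.elim t r]
            rw [this, Finset.sum_empty]
            positivity
          · have hs2 : (0 : ℝ) < s - 1 := by linarith
            have : ∀ t ∈ Finset.univ.filter fun t : Fin s => t < r,
                ∑ π : Fin s ≃ α with π r = i, β (π t) = F * D / (s - 1) := by
              intro t ht
              rw [eq_div_iff hs2.ne', mul_comm]
              exact hbef r t (Finset.mem_filter.1 ht).2.ne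
            rw [Finset.sum_congr rfl this, Finset.sum_const, nsmul_eq_mul]
            have hc : (Finset.univ.filter fun t : Fin s => t < r).card = (r : ℕ) := by
              rw [Finset.filter_gt_eq_Iio, Fin.card_Iio]
            rw [hc]
            have : F * ((r : ℕ) * ρ) * k = (r : ℕ) * (F * G / (s - 1)) := by
              rw [hρ]; field_simp
            rw [this]
            gcongr
            exact le_max_left _ _
      _ ≤ _ := Finset.sum_le_sum fun π hπ => by
          rw [e1 π hπ]
          exact le_max_right _ _
  rw [fib, hcard]
  refine le_trans ?_ (Finset.sum_le_sum fun r _ => hr r)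
  rw [← Finset.mul_sum, Fin.sum_univ_eq_sum_range (fun r : ℕ => max 0 (1 - (r : ℝ) * ρ)) s,
    mul_comm (s : ℝ), mul_assoc]
  refine mul_le_mul_of_nonneg_left ?_ hF0
  rcases hs1.eq_or_lt with h | h
  · have h' : s = 1 := by exact_mod_cast h.symm
    subst h'
    simp only [Nat.cast_one, one_mul, Finset.range_one, Finset.sum_singleton, Nat.cast_zero,
      zero_mul, sub_zero, zero_le_one, sup_of_le_right]
    rw [div_le_one (by positivity)]
    linarith [le_max_right D k]
  · have hs2 : (0 : ℝ) < s - 1 := by linarith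
    have hρ1 : 0 < ρ := div_pos hG0 (mul_pos hs2 hk)
    have h1 := le_sum_max_sub_mul hρ0 s
    have hρs : (s - 1) * k * ρ = G := by rw [hρ]; field_simp
    have hρs' : 1 ≤ (s - 1) * ρ := by
      have : k ≤ (s - 1) * k * ρ := hρs ▸ le_max_right _ _
      nlinarith
    have h2 : max 0 (1 - (s : ℝ) * ρ) = 0 := max_eq_left (by linarith)
    rw [h2] at h1
    have h3 : (s : ℝ) * (k / (2 * G)) * (2 * ρ) ≤ 1 + ρ := by
      have e : (s : ℝ) * (k / (2 * G)) * (2 * ρ) = ((s - 1) * k * ρ) / G + k * ρ / G := by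
        field_simp; ring
      rw [e, hρs, div_self hG0.ne']
      have : k * ρ / G ≤ ρ := by
        rw [div_le_iff₀ hG0, mul_comm]
        exact mul_le_mul_of_nonneg_left (le_max_right _ _) hρ0
      linarith
    nlinarith

end RandomOrder

/-! ### The allocation procedure in random order -/

section IndivAllocBound

theorem ofFn_split {n : ℕ} {β : Type} (f : Fin n → β) (r : Fin n) :
    List.ofFn f = (List.ofFn f).take r ++ f r :: (List.ofFn f).drop (r + 1) := by
  have h : (r : ℕ) < (List.ofFn f).length := by simp
  have := List.getElem_cons_drop h
  rw [List.getElem_ofFn] at this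
  rw [this, List.take_append_drop]

theorem notMem_take_drop_ofFn {ι : Type} {S : Finset ι} (π : Fin S.card ≃ S) (r : Fin S.card) :
    (π r : ι) ∉ (List.ofFn fun l => (π l : ι)).take r ∧
      (π r : ι) ∉ (List.ofFn fun l => (π l : ι)).drop (r + 1) := by
  have hnd : (List.ofFn fun l => (π l : ι)).Nodup :=
    List.nodup_ofFn.2 (Subtype.val_injective.comp π.injective)
  rw [ofFn_split (fun l => (π l : ι)) r] at hnd
  constructor
  · intro h
    exact List.disjoint_of_nodup_append hnd h List.mem_cons_self
  · exact (List.nodup_cons.1 (List.nodup_append.1 hnd).2.1).1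

variable {ι : Type} [DecidableEq ι] (v b : ι → ℝ)

theorem expect_indivAlloc (S : Finset ι) (p : ℝ) (k : ℕ) (g : (ι → ℕ) × (ι → ℝ) → ℝ) :
    expect (indivAlloc v b S p k) g =
      (∑ π : Fin S.card ≃ S, expect ((List.ofFn fun l => (π l : ι)).foldlM (indivStep v b p)
        (AllocState.init k)) fun s => g (s.alloc, s.charge)) / Fintype.card (Fin S.card ≃ S) := by
  have h := finite_support_foldlM (finite_support_indivStep v b p)
  rw [indivAlloc, expect_bind (Set.toFinite _) fun π => finite_support_map _ (h _ _),
    expect_uniformOfFintype]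
  simp only [expect_map (h _ _)]
  rfl

variable {v b}

theorem mem_support_indivAlloc (hb : ∀ i, 0 ≤ b i) {p : ℝ} (hp : 0 < p) {S : Finset ι} {k : ℕ}
    {y : (ι → ℕ) × (ι → ℝ)} (hy : y ∈ (indivAlloc v b S p k).support) (i : ι) :
    0 ≤ y.2 i ∧ y.2 i ≤ k := by
  rw [indivAlloc, PMF.mem_support_bind_iff] at hy
  obtain ⟨π, -, hy⟩ := hy
  rw [PMF.mem_support_map_iff] at hy
  obtain ⟨s, hs, rfl⟩ := hy
  exact (mem_support_foldlM (fun s t hs => indivStep_inv v b hb hp k s t hs) _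
    (AllocState.init_inv k) s hs).2 i

/-- This lets one number per buyer measure both the expected loss of stock and the expected payment
in the collection phase. -/
theorem expect_alloc_eq_expect_charge (hb : ∀ i, 0 ≤ b i) {p : ℝ} (hp : 0 < p) {S : Finset ι}
    (k : ℕ) {i : ι} (hi : i ∈ S) :
    expect (indivAlloc v b S p k) (fun y => (y.1 i : ℝ)) =
      expect (indivAlloc v b S p k) fun y => y.2 i := by
  rw [expect_indivAlloc, expect_indivAlloc]
  congr 1
  refine Finset.sum_congr rfl fun π _ => ?_
  obtain ⟨r, hr⟩ := π.surjective ⟨i, hi⟩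
  have hri : (π r : ι) = i := by rw [hr]
  obtain ⟨h1, h2⟩ := notMem_take_drop_ofFn π r
  rw [ofFn_split (fun l => (π l : ι)) r]
  rw [hri] at h1 h2 ⊢
  exact expect_alloc_eq_expect_charge_foldlM v b hb hp h1 h2

/-- The expected charge of an agent in the allocation procedure. -/
theorem le_expect_charge_indivAlloc (hb : ∀ i, 0 ≤ b i) {p : ℝ} (hp : 0 < p) {K : Finset ι}
    {k : ℕ} (hk : 0 < k) {i : ι} (hi : i ∉ K) (hd : demand v b p i ≤ k) :
    demand v b p i * (k / (2 * max (∑ t ∈ K, demand v b p t) k)) ≤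
      expect (indivAlloc v b (insert i K) p k) fun y => y.2 i := by
  set S := insert i K with hS
  have hiS : i ∈ S := Finset.mem_insert_self _ _
  have hk' : (0 : ℝ) < k := by exact_mod_cast hk
  rw [expect_indivAlloc, le_div_iff₀ (by exact_mod_cast Fintype.card_pos)]
  have hsum : ∑ a ∈ (Finset.univ : Finset S).erase ⟨i, hiS⟩, demand v b p a =
      ∑ t ∈ K, demand v b p t := by
    have h1 := Finset.add_sum_erase Finset.univ (fun a : S => demand v b p a)
      (Finset.mem_univ (⟨i, hiS⟩ : S))
    have h2 : ∑ a : S, demand v b p a = ∑ t ∈ S, demand v b p t :=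
      Finset.sum_coe_sort S (demand v b p)
    rw [hS, Finset.sum_insert hi] at h2
    simp only at h1
    linarith
  have key := le_sum_max_before (s := S.card) (fun a : S => demand v b p a)
    (fun a => demand_nonneg v b hb hp a) ⟨i, hiS⟩ hk' (Finset.card_pos.2 ⟨i, hiS⟩)
  rw [hsum] at key
  calc _ = demand v b p i * ((Fintype.card (Fin S.card ≃ S) : ℝ) *
        (k / (2 * max (∑ t ∈ K, demand v b p t) k))) := by ring
    _ ≤ demand v b p i * _ := mul_le_mul_of_nonneg_left key (demand_nonneg v b hb hp i)
    _ = ∑ π : Fin S.card ≃ S, demand v b p i *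
        max 0 (1 - (∑ t with t < π.symm ⟨i, hiS⟩, demand v b p (π t)) / k) := Finset.mul_sum _ _ _
    _ ≤ _ := Finset.sum_le_sum fun π _ => ?_
  obtain ⟨r, hr⟩ := π.surjective ⟨i, hiS⟩
  have hri : (π r : ι) = i := by rw [hr]
  obtain ⟨-, h2⟩ := notMem_take_drop_ofFn π r
  have e : (((List.ofFn fun l => (π l : ι)).take r).map (demand v b p)).sum =
      ∑ t with t < r, demand v b p (π t) := by
    rw [List.map_take, List.map_ofFn, List.sum_take_ofFn]
    rfl
  rw [hri] at h2
  have h3 := le_expect_charge_foldlM v b (l₁ := (List.ofFn fun l => (π l : ι)).take r)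
    hb hp hk h2 hd
  have h4 := ofFn_split (fun l => (π l : ι)) r
  rw [hri] at h4
  rw [← h4, e] at h3
  rw [← hr, Equiv.symm_apply_apply]
  exact h3

end IndivAllocBound

/-! ### Expected revenue of the collection phase -/

section Collection

/-- Total budget of the agents of `S` whose value is at least `p`. -/
noncomputable def budgetAt {ι : Type} (v b : ι → ℝ) (S : Finset ι) (p : ℝ) : ℝ :=
  ∑ i ∈ S with p ≤ v i, b i

theorem sum_demand {ι : Type} (v b : ι → ℝ) (S : Finset ι) (p : ℝ) :
    ∑ i ∈ S, demand v b p i = budgetAt v b S p / p := by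
  unfold demand budgetAt
  rw [← Finset.sum_filter, Finset.sum_div]

variable {n : ℕ} [NeZero n] (ω : Choices n)

theorem Choices.pivot_mem_A : ω.pivot ∈ ω.A := by simp [Choices.A, Choices.pivot]

/-- The part of `A` without the pivot whose coins differ (`c = true`) or agree (`c = false`) with
the pivot's coin. -/
def Choices.sample (c : Bool) : Finset (Fin n) :=
  (ω.A.erase ω.pivot).filter fun t => ω.coin t = xor (ω.coin ω.pivot) c

theorem Choices.A₁_eq : ω.A₁ = ω.sample true := by
  ext t
  simp only [Choices.A₁, Choices.sample, Finset.mem_filter, Finset.mem_erase, Bool.xor_true,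
    Bool.eq_not]
  constructor
  · rintro ⟨h1, h2⟩
    exact ⟨⟨fun h => h2 (h ▸ rfl), h1⟩, h2⟩
  · rintro ⟨⟨-, h1⟩, h2⟩
    exact ⟨h1, h2⟩

theorem Choices.A₂_erase_eq : ω.A₂.erase ω.pivot = ω.sample false := by
  ext t
  simp only [Choices.A₂, Choices.sample, Finset.mem_filter, Finset.mem_erase, Bool.xor_false]
  tauto

/-- The part of `B` with coin `c`. -/
def Choices.buyers (c : Bool) : Finset (Fin n) :=
  Finset.univ.filter fun t => t ∉ ω.A ∧ ω.coin t = c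

theorem Choices.mem_arrivalsB {t : Fin n} : t ∈ ω.arrivalsB ↔ t ∉ ω.A := by
  simp only [Choices.arrivalsB, List.mem_map, List.mem_filter, List.mem_finRange, true_and,
    decide_eq_true_eq, Choices.A, Finset.mem_filter, Finset.mem_univ, not_le]
  constructor
  · rintro ⟨i, hi, rfl⟩
    simpa using hi
  · intro h
    exact ⟨ω.arr.symm t, h, by simp⟩

theorem Choices.nodup_arrivalsB : ω.arrivalsB.Nodup :=
  ((List.nodup_finRange n).filter _).map ω.arr.injective

/-- Items left on the side `c` of the market. -/
def RunState.left (s : RunState n) (c : Bool) : ℕ := if c then s.m₁ else s.m₂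

variable (P : Finset (Fin n) → ℝ) (v b : Fin n → ℝ) (k : ℕ)

theorem finite_support_collectStep (s : RunState n) (t : Fin n) :
    (collectStep ω P (indivAlloc v b) k s t).support.Finite := by
  unfold collectStep
  split_ifs
  · exact finite_support_map _ (finite_support_indivAlloc v b _ _ _)
  · exact finite_support_map _ (finite_support_indivAlloc v b _ _ _)

theorem finite_support_samplingPhase (a d : Fin n → ℝ) :
    (samplingPhase ω P (indivAlloc v b) k a d).support.Finite :=
  finite_support_bind (finite_support_indivAlloc v b _ _ _) fun _ =>
    finite_support_map _ (finite_support_indivAlloc v b _ _ _)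

/-- The run of the allocation procedure for a buyer `t`. -/
noncomputable def buyerAlloc (t : Fin n) : PMF ((Fin n → ℕ) × (Fin n → ℝ)) :=
  indivAlloc v b (insert t (ω.sample (ω.coin t))) (P (ω.sample (!ω.coin t))) k

/-- The state after a buyer `t` has been served. -/
noncomputable def RunState.serve (s : RunState n) (t : Fin n) (y : (Fin n → ℕ) × (Fin n → ℝ)) :
    RunState n where
  m₁ := if ω.coin t then s.m₁ - min (y.1 t) s.m₁ else s.m₁
  m₂ := if ω.coin t then s.m₂ else s.m₂ - min (y.1 t) s.m₂
  items := Function.update s.items t (min (y.1 t) (s.left (ω.coin t)))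
  pay := Function.update s.pay t
    (min (y.2 t) (s.left (ω.coin t) : ℝ) * P (ω.sample (!ω.coin t)))

/-- With the pivot left out of A₂, heads and tails follow one rule: competition comes from `sample
c` and the price from `sample !c`. Both sides can then be treated at once. -/
theorem collectStep_eq {t : Fin n} (ht : t ∉ ω.A) (s : RunState n) :
    collectStep ω P (indivAlloc v b) k s t =
      (buyerAlloc ω P v b k t).map (s.serve ω P t) := by
  have hp : t ≠ ω.pivot := fun h => ht (h ▸ ω.pivot_mem_A)
  unfold collectStep buyerAlloc RunState.serve RunState.left
  cases hc : ω.coin t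
  · simp only [Bool.false_eq_true, if_false, Bool.not_false, ω.A₁_eq]
    rw [Finset.erase_insert_of_ne hp, ω.A₂_erase_eq]
  · simp only [if_true, Bool.not_true, ω.A₁_eq, ω.A₂_erase_eq]

theorem left_serve (s : RunState n) (t : Fin n) (y : (Fin n → ℕ) × (Fin n → ℝ)) (c : Bool) :
    (s.serve ω P t y).left c =
      if ω.coin t = c then s.left c - min (y.1 t) (s.left c) else s.left c := by
  unfold RunState.serve RunState.left
  cases ω.coin t <;> cases c <;> simp

variable {P v b k}

/-- Expected revenue from one of the two parts of `B`. -/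
theorem le_expect_pay_side (hb : ∀ i, 0 ≤ b i) (hk : 0 < k) (hP : ∀ S, 0 < P S) (c : Bool)
    (hbk : ∀ i, b i ≤ k * P (ω.sample !c)) {s : RunState n} (hs : ∀ c, s.left c = k) :
    k * P (ω.sample !c) / 2 * (1 - max 0 (1 - budgetAt v b (ω.buyers c) (P (ω.sample !c)) /
        (2 * max (budgetAt v b (ω.sample c) (P (ω.sample !c))) (k * P (ω.sample !c)))) ^ 2) ≤
      expect (ω.arrivalsB.foldlM (collectStep ω P (indivAlloc v b) k) s)
        fun s' => ∑ t ∈ ω.arrivalsB.toFinset, if ω.coin t = c then s'.pay t else 0 := by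
  set p := P (ω.sample !c) with hpdef
  have hp : 0 < p := hP _
  have hk' : (0 : ℝ) < k := by exact_mod_cast hk
  set y : Fin n → ℝ := fun t => if ω.coin t = c then
    expect (buyerAlloc ω P v b k t) (fun z => z.2 t) else 0 with hy
  have hfin : ∀ t, (buyerAlloc ω P v b k t).support.Finite := fun t =>
    finite_support_indivAlloc v b _ _ _
  have hsupp : ∀ t, ∀ z ∈ (buyerAlloc ω P v b k t).support, 0 ≤ z.2 t ∧ z.2 t ≤ k :=
    fun t z hz => mem_support_indivAlloc hb (hP _) hz t
  have hy0 : ∀ t, 0 ≤ y t := by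
    intro t
    simp only [hy]
    split_ifs
    · exact expect_nonneg (hfin t) fun z hz => (hsupp t z hz).1
    · exact le_rfl
  have key := le_expect_foldlM_sum_pay (p := p) (k := k)
    (step := collectStep ω P (indivAlloc v b) k)
    (I := fun s => ∀ c, s.left c ≤ k) (f := fun s => (s.left c : ℝ))
    (pay := fun s t => if ω.coin t = c then s.pay t else 0) (y := y) hk' hp.le
    (finite_support_collectStep ω P v b k) ?_ (fun _ _ => Nat.cast_nonneg _) hy0 ?_
    ω.arrivalsB ω.nodup_arrivalsB ?_ ?_ (s := s) (fun c => (hs c).le) (by simp [hs])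
  · refine le_trans ?_ key
    have hY : budgetAt v b (ω.buyers c) p / (2 * max (budgetAt v b (ω.sample c) p) (k * p)) ≤
        (ω.arrivalsB.map y).sum / k := by
      have e1 : (ω.arrivalsB.map y).sum = ∑ t ∈ ω.buyers c,
          expect (buyerAlloc ω P v b k t) (fun z => z.2 t) := by
        rw [← List.sum_toFinset y ω.nodup_arrivalsB, ← Finset.sum_filter]
        refine Finset.sum_congr ?_ fun _ _ => rfl
        ext t
        simp [Choices.buyers, Choices.mem_arrivalsB]
      have e2 : ∀ t ∈ ω.buyers c, demand v b p t *
          (k / (2 * max (budgetAt v b (ω.sample c) p / p) k)) ≤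
          expect (buyerAlloc ω P v b k t) (fun z => z.2 t) := by
        intro t ht
        obtain ⟨h1, h2⟩ := (Finset.mem_filter.1 ht).2
        have h3 : t ∉ ω.sample c := fun h =>
          h1 (Finset.mem_of_mem_erase (Finset.mem_filter.1 h).1)
        rw [← sum_demand, buyerAlloc, h2]
        refine le_expect_charge_indivAlloc hb hp hk h3 ?_
        unfold demand
        split_ifs
        · exact (div_le_iff₀ hp).2 (hbk t)
        · exact hk'.le
      have e3 := Finset.sum_le_sum e2
      rw [← Finset.sum_mul, sum_demand, ← e1] at e3
      rw [le_div_iff₀ hk']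
      refine le_trans (le_of_eq ?_) e3
      have e4 : max (budgetAt v b (ω.sample c) p) (k * p) =
          max (budgetAt v b (ω.sample c) p / p) k * p := by
        rw [max_mul_of_nonneg _ _ hp.le, div_mul_cancel₀ _ hp.ne']
      rw [e4]
      have : 0 < max (budgetAt v b (ω.sample c) p / p) (k : ℝ) := hk'.trans_le (le_max_right _ _)
      field_simp
    calc _ = p * (k / 2 * (1 - max 0 (1 - budgetAt v b (ω.buyers c) p /
          (2 * max (budgetAt v b (ω.sample c) p) (k * p))) ^ 2)) := by ring
      _ ≤ _ := by gcongr
  · intro s t hs s' hs' c'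
    unfold collectStep at hs'
    split_ifs at hs' <;>
    · obtain ⟨z, -, rfl⟩ := (PMF.mem_support_map_iff _ _ _).1 hs'
      have h1 := hs true
      have h2 := hs false
      cases c' <;> simp [RunState.left] at h1 h2 ⊢ <;> omega
  · intro s t u hu s' hs'
    unfold collectStep at hs'
    split_ifs at hs' <;>
    · obtain ⟨z, -, rfl⟩ := (PMF.mem_support_map_iff _ _ _).1 hs'
      simp [hu]
  · intro s t ht hs
    rw [collectStep_eq ω P v b k (ω.mem_arrivalsB.1 ht), expect_map (hfin t)]
    simp only [left_serve, hy]
    split_ifs with hc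
    -- The stock falls by the items received, while `y` is the expected charge; fairness of the
    -- lottery identifies the two means.
    · have e := expect_alloc_eq_expect_charge (v := v) hb (hP (ω.sample (!ω.coin t)))
        k (Finset.mem_insert_self t (ω.sample (ω.coin t)))
      rw [buyerAlloc, ← e]
      have hf := finite_support_indivAlloc v b (insert t (ω.sample (ω.coin t)))
        (P (ω.sample (!ω.coin t))) k
      rw [← expect_const hf (s.left c : ℝ), ← expect_sub hf]
      refine expect_mono hf fun z _ => ?_
      rw [Nat.cast_sub (min_le_right _ _)]
      have : ((min (z.1 t) (s.left c) : ℕ) : ℝ) ≤ z.1 t := by exact_mod_cast min_le_left _ _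
      linarith
    · rw [expect_const (hfin t), sub_zero]
  · intro s t ht hs
    rw [collectStep_eq ω P v b k (ω.mem_arrivalsB.1 ht), expect_map (hfin t)]
    simp only [hy]
    split_ifs with hc
    · calc p * (expect (buyerAlloc ω P v b k t) (fun z => z.2 t) * (s.left c / k))
          = expect (buyerAlloc ω P v b k t) (fun z => p * (s.left c / k) * z.2 t) := by
            rw [expect_const_mul]; ring
        _ ≤ _ := expect_mono (hfin t) fun z hz => by
            obtain ⟨h1, h2⟩ := hsupp t z hz
            have hl : (s.left c : ℝ) ≤ k := by exact_mod_cast hs c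
            have hl0 : (0 : ℝ) ≤ s.left c := Nat.cast_nonneg _
            simp only [RunState.serve, Function.update_self, hc, ← hpdef]
            -- As the charge and the stock are both at most k, the truncated charge is at least
            -- their product over k. The fresh run does not depend on the stock.
            have : (s.left c / k : ℝ) * z.2 t ≤ min (z.2 t) (s.left c) := by
              refine le_min ?_ ?_
              · have : (s.left c / k : ℝ) ≤ 1 := (div_le_one hk').2 hl
                nlinarith
              · rw [div_mul_eq_mul_div, div_le_iff₀ hk']
                exact mul_le_mul_of_nonneg_left h2 hl0
            nlinarith
    · rw [expect_const (hfin t)]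
      simp

theorem pay_nonneg_collect (hb : ∀ i, 0 ≤ b i) (hP : ∀ S, 0 < P S) {s : RunState n}
    (hs : ∀ t, 0 ≤ s.pay t) :
    ∀ s' ∈ (ω.arrivalsB.foldlM (collectStep ω P (indivAlloc v b) k) s).support,
      ∀ t, 0 ≤ s'.pay t := by
  refine mem_support_foldlM ?_ _ hs
  intro s t hs s' hs' u
  unfold collectStep at hs'
  split_ifs at hs' <;>
  · obtain ⟨z, hz, rfl⟩ := (PMF.mem_support_map_iff _ _ _).1 hs'
    rcases eq_or_ne u t with rfl | hu
    · simp only [Function.update_self]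
      exact mul_nonneg (le_min (mem_support_indivAlloc hb (hP _) hz u).1 (Nat.cast_nonneg _))
        (hP _).le
    · simpa [hu] using hs u

theorem mem_support_samplingPhase (hb : ∀ i, 0 ≤ b i) (hP : ∀ S, 0 < P S) {a d : Fin n → ℝ}
    {s : RunState n} (hs : s ∈ (samplingPhase ω P (indivAlloc v b) k a d).support) :
    (∀ c, s.left c = k) ∧ ∀ t, 0 ≤ s.pay t := by
  obtain ⟨y, hy, hs⟩ := (PMF.mem_support_bind_iff _ _ _).1 hs
  obtain ⟨z, hz, rfl⟩ := (PMF.mem_support_map_iff _ _ _).1 hs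
  refine ⟨fun c => by cases c <;> simp [RunState.left], fun t => ?_⟩
  simp only
  split_ifs
  · exact mul_nonneg (mem_support_indivAlloc hb (hP _) hy t).1 (hP _).le
  · exact mul_nonneg (mem_support_indivAlloc hb (hP _) hz t).1 (hP _).le
  · exact le_rfl
  · exact le_rfl

/-- The expected revenue is at least the revenue from the two parts of `B`. -/
theorem le_revIndiv (hb : ∀ i, 0 ≤ b i) (hP : ∀ S, 0 < P S) {m : ℕ} {a d : Fin n → ℝ}
    {r : Bool → ℝ}
    (hr : ∀ c, ∀ s : RunState n, (∀ c, s.left c = m / 4) → r c ≤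
      expect (ω.arrivalsB.foldlM (collectStep ω P (indivAlloc v b) (m / 4)) s)
        fun s' => ∑ t ∈ ω.arrivalsB.toFinset, if ω.coin t = c then s'.pay t else 0) :
    r true + r false ≤ revIndiv ω P v b m a d := by
  have hfin := finite_support_foldlM (finite_support_collectStep ω P v b (m / 4)) ω.arrivalsB
  rw [revIndiv, rsOnline, expect_bind (finite_support_samplingPhase ω P v b _ a d) hfin]
  refine le_expect (finite_support_samplingPhase ω P v b _ a d) fun s hs => ?_
  obtain ⟨h1, h2⟩ := mem_support_samplingPhase ω hb hP hs
  refine (add_le_add (hr true s h1) (hr false s h1)).trans ?_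
  rw [← expect_add (hfin s)]
  refine expect_mono (hfin s) fun s' hs' => ?_
  have h3 := pay_nonneg_collect ω hb hP h2 s' hs'
  rw [← Finset.sum_add_distrib]
  calc _ = ∑ t ∈ ω.arrivalsB.toFinset, s'.pay t :=
        Finset.sum_congr rfl fun t _ => by cases ω.coin t <;> simp
    -- Payments of the sampled agents are nonnegative and are discarded.
    _ ≤ _ := Finset.sum_le_univ_sum_of_nonneg h3

end Collection

/-! ### Chernoff bounds for independent uniform labels, in counting form -/

section Concentration

theorem exp_neg_le_quadratic {s : ℝ} (hs : 0 ≤ s) : Real.exp (-s) ≤ 1 - s + s ^ 2 / 2 := by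
  have h1 := Real.quadratic_le_exp_of_nonneg hs
  have h2 : 0 < 1 + s + s ^ 2 / 2 := by positivity
  rw [Real.exp_neg]
  calc (Real.exp s)⁻¹ ≤ (1 + s + s ^ 2 / 2)⁻¹ := inv_anti₀ h2 h1
    _ ≤ 1 - s + s ^ 2 / 2 := by
      rw [inv_le_iff_one_le_mul₀ h2]
      -- (1 + s + s²/2)(1 - s + s²/2) = 1 + s⁴/4.
      nlinarith [sq_nonneg (s ^ 2)]

theorem exp_le_quadratic {s : ℝ} (hs : 0 ≤ s) (hs1 : s ≤ 1) : Real.exp s ≤ 1 + s + s ^ 2 := by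
  have := Real.abs_exp_sub_one_sub_id_le (x := s) (by rwa [abs_of_nonneg hs])
  have := le_abs_self (Real.exp s - 1 - s)
  linarith

variable {ι L : Type} [Fintype ι] [DecidableEq ι]

/-- Chernoff's bound for independent labels, the label of `t` being uniform on `a t`. -/
theorem card_filter_le_exp (a : ι → Finset L) (f : ι → L → ℝ) (c : ι → ℝ) (T : ℝ)
    (h : ∀ t, ∑ x ∈ a t, Real.exp (f t x) ≤ (a t).card * Real.exp (c t)) :
    (((Fintype.piFinset a).filter fun l => T ≤ ∑ t, f t (l t)).card : ℝ) ≤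
      (Fintype.piFinset a).card * Real.exp (∑ t, c t - T) := by
  calc (((Fintype.piFinset a).filter fun l => T ≤ ∑ t, f t (l t)).card : ℝ)
      = ∑ l ∈ Fintype.piFinset a, if T ≤ ∑ t, f t (l t) then (1 : ℝ) else 0 := by
        rw [Finset.card_filter]; push_cast; rfl
    _ ≤ ∑ l ∈ Fintype.piFinset a, Real.exp (∑ t, f t (l t)) * Real.exp (-T) := by
        refine Finset.sum_le_sum fun l _ => ?_
        rw [← Real.exp_add]
        split_ifs with hT
        · exact Real.one_le_exp (by linarith)
        · exact (Real.exp_pos _).le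
    _ = (∏ t, ∑ x ∈ a t, Real.exp (f t x)) * Real.exp (-T) := by
        rw [← Finset.sum_mul, Finset.prod_univ_sum]
        simp only [Real.exp_sum]
    _ ≤ (∏ t, ((a t).card * Real.exp (c t))) * Real.exp (-T) := by
        refine mul_le_mul_of_nonneg_right ?_ (Real.exp_pos _).le
        exact Finset.prod_le_prod (fun t _ => Finset.sum_nonneg fun x _ => (Real.exp_pos _).le)
          fun t _ => h t
    _ = _ := by
        rw [Finset.prod_mul_distrib, ← Real.exp_sum, mul_assoc, ← Real.exp_add,
          Fintype.card_piFinset, sub_eq_add_neg]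
        push_cast
        rfl

variable [DecidableEq L]

theorem sum_exp_ite (a : Finset L) {z : L} (hz : z ∈ a) (r : ℝ) :
    ∑ x ∈ a, Real.exp (if x = z then r else 0) = a.card - 1 + Real.exp r := by
  rw [← Finset.add_sum_erase _ _ hz, if_pos rfl]
  have : ∀ x ∈ a.erase z, Real.exp (if x = z then r else 0) = 1 := by
    intro x hx
    rw [if_neg (Finset.ne_of_mem_erase hx), Real.exp_zero]
  rw [Finset.sum_congr rfl this, Finset.sum_const, nsmul_eq_mul, mul_one,
    Finset.card_erase_of_mem hz, Nat.cast_sub (Finset.card_pos.2 ⟨z, hz⟩), Nat.cast_one]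
  ring

variable (a : ι → Finset L) (V : Finset ι) (z : L) {q : ℕ} (hq : 0 < q)
  (haq : ∀ t ∈ V, (a t).card = q) (haz : ∀ t ∈ V, z ∈ a t) (w : ι → ℝ) {β lam : ℝ}
  (hw : ∀ t, 0 ≤ w t) (hβ : ∀ t, w t ≤ β) (hlam : 0 ≤ lam)

include hq haq haz hw hβ hlam

/-- Exponential moment bound at -λ: e^{-s} ≤ 1 - s + s²/2 with s = λw and w ≤ β makes the quadratic
term at most λβ/2 times the linear one. The parameter λ stays free, to be chosen per application. -/
theorem card_lower_tail_le (T : ℝ) :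
    (((Fintype.piFinset a).filter fun l => ∑ t ∈ V with l t = z, w t ≤ T).card : ℝ) ≤
      (Fintype.piFinset a).card *
        Real.exp (lam * T - lam * (1 - lam * β / 2) / q * ∑ t ∈ V, w t) := by
  have hq' : (0 : ℝ) < q := by exact_mod_cast hq
  have key := card_filter_le_exp a
    (fun t x => if t ∈ V then (if x = z then -(lam * w t) else 0) else 0)
    (fun t => if t ∈ V then -(lam * (1 - lam * β / 2) / q * w t) else 0) (-(lam * T)) ?_
  · refine le_trans (Nat.cast_le.2 (Finset.card_le_card ?_)) (key.trans (le_of_eq ?_))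
    · refine Finset.monotone_filter_right _ fun l _ hl => ?_
      have e : ∑ t, (if t ∈ V then (if l t = z then -(lam * w t) else 0) else 0) =
          -(lam * ∑ t ∈ V with l t = z, w t) := by
        rw [← Finset.sum_filter, Finset.filter_mem_eq_inter, Finset.univ_inter,
          ← Finset.sum_filter, Finset.sum_neg_distrib, Finset.mul_sum]
      rw [e]
      exact neg_le_neg (mul_le_mul_of_nonneg_left hl hlam)
    · congr 2
      rw [← Finset.sum_filter, Finset.filter_mem_eq_inter, Finset.univ_inter,
        Finset.sum_neg_distrib, Finset.mul_sum]
      ring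
  · intro t
    by_cases ht : t ∈ V
    · simp only [if_pos ht]
      rw [sum_exp_ite _ (haz t ht), haq t ht]
      have h1 := exp_neg_le_quadratic (mul_nonneg hlam (hw t))
      have h2 : (lam * w t) ^ 2 ≤ lam * w t * (lam * β) := by
        rw [sq]
        exact mul_le_mul_of_nonneg_left (mul_le_mul_of_nonneg_left (hβ t) hlam)
          (mul_nonneg hlam (hw t))
      have h3 := Real.add_one_le_exp (-(lam * (1 - lam * β / 2) / q * w t))
      have h4 : (q : ℝ) * (-(lam * (1 - lam * β / 2) / q * w t) + 1) =
          q - lam * w t + lam * w t * (lam * β) / 2 := by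
        field_simp
        ring
      have h5 := mul_le_mul_of_nonneg_left h3 hq'.le
      linarith
    · simp [ht]

/-- The same argument at +λ. The condition on λβ keeps the exponent in the range where e^s ≤ 1 + s +
s². -/
theorem card_upper_tail_le (hlamβ : lam * β ≤ 1) (T : ℝ) :
    (((Fintype.piFinset a).filter fun l => T ≤ ∑ t ∈ V with l t = z, w t).card : ℝ) ≤
      (Fintype.piFinset a).card *
        Real.exp (lam * (1 + lam * β) / q * ∑ t ∈ V, w t - lam * T) := by
  have hq' : (0 : ℝ) < q := by exact_mod_cast hq
  have key := card_filter_le_exp a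
    (fun t x => if t ∈ V then (if x = z then lam * w t else 0) else 0)
    (fun t => if t ∈ V then lam * (1 + lam * β) / q * w t else 0) (lam * T) ?_
  · refine le_trans (Nat.cast_le.2 (Finset.card_le_card ?_)) (key.trans (le_of_eq ?_))
    · refine Finset.monotone_filter_right _ fun l _ hl => ?_
      have e : ∑ t, (if t ∈ V then (if l t = z then lam * w t else 0) else 0) =
          lam * ∑ t ∈ V with l t = z, w t := by
        rw [← Finset.sum_filter, Finset.filter_mem_eq_inter, Finset.univ_inter,
          ← Finset.sum_filter, Finset.mul_sum]
      rw [e]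
      exact mul_le_mul_of_nonneg_left hl hlam
    · congr 2
      rw [← Finset.sum_filter, Finset.filter_mem_eq_inter, Finset.univ_inter, Finset.mul_sum]
  · intro t
    by_cases ht : t ∈ V
    · simp only [if_pos ht]
      rw [sum_exp_ite _ (haz t ht), haq t ht]
      have h0 : lam * w t ≤ lam * β := mul_le_mul_of_nonneg_left (hβ t) hlam
      have h1 := exp_le_quadratic (mul_nonneg hlam (hw t)) (h0.trans hlamβ)
      have h2 : (lam * w t) ^ 2 ≤ lam * w t * (lam * β) := by
        rw [sq]
        exact mul_le_mul_of_nonneg_left h0 (mul_nonneg hlam (hw t))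
      have h3 := Real.add_one_le_exp (lam * (1 + lam * β) / q * w t)
      have h4 : (q : ℝ) * (lam * (1 + lam * β) / q * w t + 1) =
          q + lam * w t + lam * w t * (lam * β) := by
        field_simp
        ring
      have h5 := mul_le_mul_of_nonneg_left h3 hq'.le
      linarith
    · simp [ht]

end Concentration

/-! ### Concentration for the four label classes -/

section Labels

variable {n : ℕ}

/-- The agents other than `j` with label `x`. -/
def labelClass (l : Fin n → Bool × Bool) (j : Fin n) (x : Bool × Bool) : Finset (Fin n) :=
  (Finset.univ.erase j).filter fun t => l t = x

/-- The labels allowed to the agents when `j` has the label `x₀`. -/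
def pinned (j : Fin n) (x₀ : Bool × Bool) (t : Fin n) : Finset (Bool × Bool) :=
  if t = j then {x₀} else Finset.univ

theorem mem_piFinset_pinned {j : Fin n} {x₀ : Bool × Bool} {l : Fin n → Bool × Bool} :
    l ∈ Fintype.piFinset (pinned j x₀) ↔ l j = x₀ := by
  rw [Fintype.mem_piFinset]
  constructor
  · intro h
    simpa [pinned] using h j
  · intro h t
    unfold pinned
    split_ifs with ht
    · simp [ht, h]
    · simp

theorem card_piFinset_pinned (j : Fin n) (x₀ : Bool × Bool) :
    (Fintype.piFinset (pinned j x₀)).card = 4 ^ (n - 1) := by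
  rw [Fintype.card_piFinset, ← Finset.mul_prod_erase _ _ (Finset.mem_univ j)]
  have : ∀ t ∈ Finset.univ.erase j, (pinned j x₀ t).card = 4 := by
    intro t ht
    simp [pinned, Finset.ne_of_mem_erase ht]
  rw [Finset.prod_congr rfl this, Finset.prod_const, Finset.card_erase_of_mem (Finset.mem_univ _)]
  simp [pinned]

variable (j : Fin n) (x₀ : Bool × Bool) {w : Fin n → ℝ} {β : ℝ} (hβ0 : 0 < β)

include hβ0

/-- The mean is at least (O - β)/4, well above O/6. With λ = 1/(3β) the exponent has room to spare
over the common rate 1/144. -/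
theorem card_labelClass_lower (hw : ∀ t, 0 ≤ w t) (hβ : ∀ t, w t ≤ β) (x : Bool × Bool) {O : ℝ}
    (hO : 100 * β ≤ O) (hW : O - β ≤ ∑ t ∈ Finset.univ.erase j, w t) :
    (((Fintype.piFinset (pinned j x₀)).filter fun l =>
      ∑ t ∈ labelClass l j x, w t ≤ O / 6).card : ℝ) ≤
      4 ^ (n - 1) * Real.exp (-(O / (144 * β))) := by
  have key := card_lower_tail_le (pinned j x₀) (Finset.univ.erase j) x (q := 4) (by norm_num)
    (fun t ht => by simp [pinned, Finset.ne_of_mem_erase ht])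
    (fun t ht => by simp [pinned, Finset.ne_of_mem_erase ht]) w hw hβ
    (lam := 1 / (3 * β)) (by positivity) (O / 6)
  rw [card_piFinset_pinned] at key
  push_cast at key
  refine key.trans ?_
  gcongr
  have e : 1 / (3 * β) * (O / 6) - 1 / (3 * β) * (1 - 1 / (3 * β) * β / 2) / 4 *
      ∑ t ∈ Finset.univ.erase j, w t =
      (O / 18 - 5 / 72 * ∑ t ∈ Finset.univ.erase j, w t) / β := by
    field_simp; ring
  have e2 : -(O / (144 * β)) = -(O / 144) / β := by field_simp
  rw [e, e2]
  gcongr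
  linarith

/-- The mean is at most 5O/48, below O/6 = 8O/48. Here λ = 3/(10β) reaches the rate 1/144. -/
theorem card_labelClass_upper (hw : ∀ t, 0 ≤ w t) (hβ : ∀ t, w t ≤ β) (x : Bool × Bool) {O : ℝ}
    (hO : 0 < O) (hW : ∑ t ∈ Finset.univ.erase j, w t ≤ 5 / 12 * O) :
    (((Fintype.piFinset (pinned j x₀)).filter fun l =>
      O / 6 ≤ ∑ t ∈ labelClass l j x, w t).card : ℝ) ≤
      4 ^ (n - 1) * Real.exp (-(O / (144 * β))) := by
  have key := card_upper_tail_le (pinned j x₀) (Finset.univ.erase j) x (q := 4) (by norm_num)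
    (fun t ht => by simp [pinned, Finset.ne_of_mem_erase ht])
    (fun t ht => by simp [pinned, Finset.ne_of_mem_erase ht]) w hw hβ
    (lam := 3 / (10 * β)) (by positivity) (by field_simp; norm_num) (O / 6)
  rw [card_piFinset_pinned] at key
  push_cast at key
  refine key.trans ?_
  gcongr
  have e : 3 / (10 * β) * (1 + 3 / (10 * β) * β) / 4 * ∑ t ∈ Finset.univ.erase j, w t -
      3 / (10 * β) * (O / 6) =
      (39 / 400 * ∑ t ∈ Finset.univ.erase j, w t - O / 20) / β := by
    field_simp; ring
  have e2 : -(O / (144 * β)) = -(O / 144) / β := by field_simp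
  rw [e, e2]
  gcongr
  linarith

/-- Weights that depend on the class of `x` are shared fairly with the class of `z`. -/
theorem card_labelClass_share {w : Finset (Fin n) → Fin n → ℝ} (hw : ∀ U t, 0 ≤ w U t)
    (hβ : ∀ U t, w U t ≤ β) {x z : Bool × Bool} (hxz : z ≠ x) {O : ℝ} (hO : 100 * β ≤ O) :
    (((Fintype.piFinset (pinned j x₀)).filter fun l =>
      O / 4 - β ≤ ∑ t ∈ Finset.univ.erase j \ labelClass l j x, w (labelClass l j x) t ∧
      ∑ t ∈ labelClass l j z, w (labelClass l j x) t ≤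
        (∑ t ∈ Finset.univ.erase j \ labelClass l j x, w (labelClass l j x) t) / 6).card : ℝ) ≤
      4 ^ (n - 1) * Real.exp (-(O / (144 * β))) := by
  classical
  rw [← Nat.cast_ofNat (R := ℝ) (n := 4), ← Nat.cast_pow, ← card_piFinset_pinned j x₀,
    Finset.card_eq_sum_card_fiberwise (f := fun l => labelClass l j x) (t := Finset.univ)
      (by simp),
    Finset.card_eq_sum_card_fiberwise (s := Fintype.piFinset _) (f := fun l => labelClass l j x)
      (t := Finset.univ) (by simp)]
  push_cast
  rw [Finset.sum_mul]
  -- Condition on the class of `x` being `U`; this fixes the weights `w U`, and the bound is proved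
  -- on each fiber.
  refine Finset.sum_le_sum fun U _ => ?_
  rw [Finset.filter_filter]
  set M := ∑ t ∈ Finset.univ.erase j \ U, w U t with hM
  by_cases hU : j ∉ U ∧ O / 4 - β ≤ M
  -- The fiber is again a product: outside `U` and `j` a label is uniform on the three values other
  -- than `x`, so the tail bound applies with q = 3.
  · let a : Fin n → Finset (Bool × Bool) := fun t =>
      if t = j then {x₀} else if t ∈ U then {x} else Finset.univ.erase x
    have ha : ((Fintype.piFinset (pinned j x₀)).filter fun l => labelClass l j x = U) =
        Fintype.piFinset a := by
      ext l
      rw [Finset.mem_filter, mem_piFinset_pinned, Fintype.mem_piFinset]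
      constructor
      · rintro ⟨h1, h2⟩ t
        simp only [a]
        have h3 : t ∈ U ↔ t ≠ j ∧ l t = x := by simp [← h2, labelClass]
        split_ifs with ht ht'
        · simp [ht, h1]
        · simpa using (h3.1 ht').2
        · simp only [Finset.mem_erase, Finset.mem_univ, and_true]
          exact fun h => ht' (h3.2 ⟨ht, h⟩)
      · intro h
        refine ⟨by simpa [a] using h j, ?_⟩
        ext t
        have h1 := h t
        simp only [a] at h1
        simp only [labelClass, Finset.mem_filter, Finset.mem_erase, Finset.mem_univ, and_true]
        split_ifs at h1 with ht ht'
        · simp [ht, hU.1]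
        · simp [ht, ht', Finset.mem_singleton.1 h1]
        · simp [ht, ht', Finset.ne_of_mem_erase h1]
    have hV : ∀ t ∈ Finset.univ.erase j \ U, t ≠ j ∧ t ∉ U := by
      intro t ht
      simpa using ht
    have key := card_lower_tail_le a (Finset.univ.erase j \ U) z (q := 3) (by norm_num)
      (fun t ht => by simp [a, hV t ht])
      (fun t ht => by simp [a, hV t ht, hxz]) (w U) (hw U) (hβ U)
      (lam := 1 / (2 * β)) (by positivity) (M / 6)
    rw [← ha] at key
    refine le_trans (Nat.cast_le.2 (Finset.card_le_card ?_)) (key.trans ?_)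
    · intro l hl
      obtain ⟨h1, ⟨h2, h3⟩, h4⟩ := Finset.mem_filter.1 hl
      refine Finset.mem_filter.2 ⟨Finset.mem_filter.2 ⟨h1, h4⟩, ?_⟩
      rw [h4] at h3
      refine le_trans (le_of_eq ?_) h3
      refine Finset.sum_congr ?_ fun _ _ => rfl
      ext t
      simp only [labelClass, Finset.mem_filter, Finset.mem_sdiff, Finset.mem_erase,
        Finset.mem_univ, and_true, ← h4]
      constructor
      · rintro ⟨⟨h5, -⟩, h6⟩
        exact ⟨h5, h6⟩
      · rintro ⟨h5, h6⟩
        exact ⟨⟨h5, fun h => hxz (h6 ▸ h.2)⟩, h6⟩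
    · gcongr
      -- The exponent is -M/(24β), and M ≥ O/4 - β ≥ 0.24 O yields at least 0.01 O/β > O/(144β).
      have e : 1 / (2 * β) * (M / 6) - 1 / (2 * β) * (1 - 1 / (2 * β) * β / 2) / (3 : ℕ) * M =
          -(M / 24) / β := by
        field_simp; push_cast; ring
      have e2 : -(O / (144 * β)) = -(O / 144) / β := by field_simp
      rw [← hM, e, e2]
      exact div_le_div_of_nonneg_right (by linarith [hU.2]) hβ0.le
  · rw [Finset.card_eq_zero.2]
    · simp only [Nat.cast_zero]
      positivity
    · refine Finset.filter_eq_empty_iff.2 fun l _ h => hU ?_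
      obtain ⟨⟨h1, -⟩, rfl⟩ := h
      exact ⟨by simp [labelClass], h1⟩

end Labels

/-! ### The joint law of the pivot and the labels -/

section Law

open scoped Nat

variable {n : ℕ}

theorem card_bool_fun_le (N r : ℕ) :
    (Finset.univ.filter fun c : Fin N → Bool =>
      (Finset.univ.filter fun l => c l = true).card = r).card ≤ N.choose r := by
  have h : (Finset.powersetCard r (Finset.univ : Finset (Fin N))).card = N.choose r := by
    rw [Finset.card_powersetCard, Finset.card_univ, Fintype.card_fin]
  rw [← h]
  refine Finset.card_le_card_of_injOn (fun c => Finset.univ.filter fun l => c l = true) ?_ ?_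
  · intro c hc
    simpa [Finset.mem_powersetCard] using hc
  · intro c _ c' _ h
    funext l
    have := congrArg (l ∈ ·) h
    simp only [Finset.mem_filter, Finset.mem_univ, true_and, eq_iff_iff] at this
    exact Bool.eq_iff_iff.2 this

/-- Such an order amounts to an order of `U` on the positions before `r` and one of the remaining
agents on the positions after it. -/
theorem card_perm_le (r : Fin n) (j : Fin n) (U : Finset (Fin n)) (hU : U.card = r)
    (hj : j ∉ U) :
    (Finset.univ.filter fun e : Equiv.Perm (Fin n) =>
      e r = j ∧ ∀ t, e t ∈ U ↔ t < r).card ≤ (r : ℕ)! * (n - 1 - r)! := by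
  classical
  set W : Finset (Fin n) := Finset.univ \ insert j U with hW
  have hWc : W.card = n - 1 - r := by
    rw [hW, Finset.card_sdiff_of_subset (Finset.subset_univ _), Finset.card_insert_of_notMem hj,
      hU, Finset.card_univ, Fintype.card_fin]
    omega
  have h1 : Fintype.card ({t : Fin n // t < r} ↪ U) = (r : ℕ)! := by
    rw [Fintype.card_embedding_eq, Fintype.card_coe, hU, Fintype.card_subtype,
      Finset.filter_gt_eq_Iio, Fin.card_Iio, Nat.descFactorial_self]
  have h2 : Fintype.card ({t : Fin n // r < t} ↪ W) = (n - 1 - r)! := by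
    rw [Fintype.card_embedding_eq, Fintype.card_coe, hWc, Fintype.card_subtype,
      Finset.filter_lt_eq_Ioi, Fin.card_Ioi, Nat.descFactorial_self]
  rw [← Fintype.card_subtype, ← h1, ← h2, ← Fintype.card_prod]
  refine Fintype.card_le_of_injective (fun e =>
    (⟨fun t => ⟨e.1 t, (e.2.2 t).2 t.2⟩, fun t t' h => ?_⟩,
      ⟨fun t => ⟨e.1 t, ?_⟩, fun t t' h => ?_⟩)) ?_
  · exact Subtype.ext (e.1.injective (congrArg Subtype.val h))
  · simp only [hW, Finset.mem_sdiff, Finset.mem_univ, Finset.mem_insert, true_and, not_or]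
    refine ⟨fun h => ?_, fun h => ?_⟩
    · exact t.2.ne (e.1.injective (e.2.1.trans h.symm))
    · exact lt_asymm t.2 ((e.2.2 t).1 h)
  · exact Subtype.ext (e.1.injective (congrArg Subtype.val h))
  · intro e e' h
    refine Subtype.ext (Equiv.ext fun t => ?_)
    rw [Prod.mk.injEq] at h
    rcases lt_trichotomy t r with ht | rfl | ht
    · exact congrArg Subtype.val (DFunLike.congr_fun h.1 ⟨t, ht⟩)
    · rw [e.2.1, e'.2.1]
    · exact congrArg Subtype.val (DFunLike.congr_fun h.2 ⟨t, ht⟩)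

theorem card_choices : Fintype.card (Choices n) = n ! * 2 ^ (n - 1) * 2 ^ n := by
  rw [Fintype.card_congr (Choices.equivProd n), Fintype.card_prod, Fintype.card_prod,
    Fintype.card_perm]
  simp [mul_assoc]

theorem prob_choicesDist (E : Set (Choices n)) [DecidablePred (· ∈ E)] :
    prob (choicesDist n) E =
      1 - ((Finset.univ.filter fun ω => ω ∉ E).card : ℝ) / Fintype.card (Choices n) := by
  rw [prob, choicesDist, PMF.toOuterMeasure_uniformOfFintype_apply, Fintype.card_subtype]
  have h := Finset.card_filter_add_card_filter_not (s := (Finset.univ : Finset (Choices n)))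
    (fun ω => ω ∈ E)
  rw [Finset.card_univ] at h
  have hpos : (0 : ℝ) < Fintype.card (Choices n) := by exact_mod_cast Fintype.card_pos
  rw [ENNReal.toReal_div, ENNReal.toReal_natCast, ENNReal.toReal_natCast, eq_sub_iff_add_eq,
    ← add_div, div_eq_one_iff_eq hpos.ne']
  exact_mod_cast h

variable [NeZero n]

/-- The label of an agent: is she in the sampling set, and what does her coin show? -/
def Choices.label (ω : Choices n) (t : Fin n) : Bool × Bool := (decide (t ∈ ω.A), ω.coin t)

/-- The labels fix A∖{j} and all the agents' coins. If A∖{j} has r elements, there are r!(n-1-r)!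
arrival orders and C(n-1,r) outcomes of the size coins. Their product is (n-1)! for every r, so the
binomial size of A makes membership in A a fair coin. -/
theorem card_label_eq_le (j : Fin n) (l : Fin n → Bool × Bool) :
    (Finset.univ.filter fun ω : Choices n => ω.pivot = j ∧ ω.label = l).card ≤ (n - 1)! := by
  classical
  set U : Finset (Fin n) := (Finset.univ.filter fun t => (l t).1 = true).erase j with hU
  have hj : j ∉ U := by simp [hU]
  have hA : ∀ ω : Choices n, ω.pivot = j → ω.label = l →
      ∀ t, ω.arr t ∈ U ↔ t < ω.pivotPos := by
    rintro ω rfl rfl t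
    simp only [hU, Choices.label, Choices.A, Finset.mem_erase, Finset.mem_filter,
      Finset.mem_univ, true_and, decide_eq_true_eq, Equiv.symm_apply_apply, Choices.pivot, ne_eq,
      EmbeddingLike.apply_eq_iff_eq]
    rw [lt_iff_le_and_ne, and_comm]
  have hcard : ∀ ω : Choices n, ω.pivot = j → ω.label = l → (ω.pivotPos : ℕ) = U.card := by
    intro ω h1 h2
    have e : U = (Finset.Iio ω.pivotPos).map ω.arr.toEmbedding := by
      ext t
      rw [Finset.mem_map_equiv, Finset.mem_Iio, ← hA ω h1 h2, Equiv.apply_symm_apply]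
    rw [e, Finset.card_map, Fin.card_Iio]
  have hr : U.card < n := by
    have := Finset.card_lt_univ_of_notMem hj
    simpa using this
  let r : Fin n := ⟨U.card, hr⟩
  let X := Finset.univ.filter fun e : Equiv.Perm (Fin n) => e r = j ∧ ∀ t, e t ∈ U ↔ t < r
  let Y := Finset.univ.filter fun c : Fin (n - 1) → Bool =>
      (Finset.univ.filter fun l => c l = true).card = U.card
  have hXY : (Finset.univ.filter fun ω : Choices n => ω.pivot = j ∧ ω.label = l).card ≤
      (X ×ˢ Y).card := by
    refine Finset.card_le_card_of_injOn (fun ω => (ω.arr, ω.sizeCoin)) ?_ ?_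
    · intro ω hω
      obtain ⟨h1, h2⟩ := (Finset.mem_filter.1 hω).2
      have h3 : ω.pivotPos = r := Fin.ext (hcard ω h1 h2)
      refine Finset.mem_coe.2 (Finset.mem_product.2 ⟨Finset.mem_filter.2 ⟨Finset.mem_univ _, ?_, ?_⟩,
        Finset.mem_filter.2 ⟨Finset.mem_univ _, ?_⟩⟩)
      · rw [← h3]; exact h1
      · rw [← h3]; exact hA ω h1 h2
      · exact hcard ω h1 h2
    · rintro ⟨e, s, c⟩ h ⟨e', s', c'⟩ h' heq
      have hc := (Finset.mem_filter.1 (Finset.mem_coe.1 h)).2.2.trans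
        (Finset.mem_filter.1 (Finset.mem_coe.1 h')).2.2.symm
      obtain ⟨h1, h2⟩ := Prod.mk.inj heq
      simp only at h1 h2
      have h3 : c = c' := funext fun t => congrArg Prod.snd (congrFun hc t)
      rw [h1, h2, h3]
  refine hXY.trans ?_
  rw [Finset.card_product]
  have hr1 : U.card ≤ n - 1 := by omega
  calc X.card * Y.card ≤ ((r : ℕ)! * (n - 1 - r)!) * (n - 1).choose U.card :=
        Nat.mul_le_mul (card_perm_le r j U rfl hj) (card_bool_fun_le _ _)
    _ = (n - 1)! := by
        rw [mul_comm, ← mul_assoc]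
        exact Nat.choose_mul_factorial_mul_factorial hr1

/-- The pivot is uniform, and the labels of the other agents are independent and uniform. -/
theorem card_bad_le (bad : Fin n → (Fin n → Bool × Bool) → Prop) {η : ℝ}
    [∀ j l, Decidable (bad j l)]
    (h : ∀ j c, (((Fintype.piFinset (pinned j (true, c))).filter fun l => bad j l).card : ℝ) ≤
      4 ^ (n - 1) * η) :
    ((Finset.univ.filter fun ω : Choices n => bad ω.pivot ω.label).card : ℝ) ≤
      Fintype.card (Choices n) * η := by
  classical
  let T : Finset (Fin n × (Fin n → Bool × Bool)) := Finset.univ.biUnion fun j =>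
    Finset.univ.biUnion fun c =>
      ((Fintype.piFinset (pinned j (true, c))).filter fun l => bad j l).image fun l => (j, l)
  have hT : (T.card : ℝ) ≤ n * 2 * (4 ^ (n - 1) * η) := by
    have h1 : T.card ≤ ∑ j : Fin n, ∑ c : Bool,
        ((Fintype.piFinset (pinned j (true, c))).filter fun l => bad j l).card :=
      Finset.card_biUnion_le.trans (Finset.sum_le_sum fun j _ =>
        Finset.card_biUnion_le.trans (Finset.sum_le_sum fun c _ => Finset.card_image_le))
    calc (T.card : ℝ) ≤ ∑ j : Fin n, ∑ c : Bool,
          (((Fintype.piFinset (pinned j (true, c))).filter fun l => bad j l).card : ℝ) := by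
          exact_mod_cast h1
      _ ≤ ∑ j : Fin n, ∑ c : Bool, (4 ^ (n - 1) * η) :=
          Finset.sum_le_sum fun j _ => Finset.sum_le_sum fun c _ => h j c
      _ = _ := by
          simp
          ring
  have h2 : (Finset.univ.filter fun ω : Choices n => bad ω.pivot ω.label).card ≤
      (n - 1)! * T.card := by
    refine Finset.card_le_mul_card_image_of_maps_to (f := fun ω => (ω.pivot, ω.label)) ?_ _ ?_
    · intro ω hω
      have hb := (Finset.mem_filter.1 hω).2
      refine Finset.mem_biUnion.2 ⟨ω.pivot, Finset.mem_univ _, Finset.mem_biUnion.2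
        ⟨ω.coin ω.pivot, Finset.mem_univ _, Finset.mem_image.2 ⟨ω.label, ?_, rfl⟩⟩⟩
      exact Finset.mem_filter.2 ⟨mem_piFinset_pinned.2 (by simp [Choices.label, ω.pivot_mem_A]), hb⟩
    · rintro ⟨j, l⟩ -
      refine le_trans (Finset.card_le_card ?_) (card_label_eq_le j l)
      intro ω hω
      obtain ⟨h3, h4⟩ := Finset.mem_filter.1 hω
      obtain ⟨h5, h6⟩ := Prod.mk.inj h4
      exact Finset.mem_filter.2 ⟨Finset.mem_univ _, h5, h6⟩
  -- The pairs of a pivot and a labelling with the pivot in A number n·2·4^(n-1); times (n-1)! this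
  -- is exactly the number n!·2^(n-1)·2^n of all choices, so the fiberwise upper bound loses
  -- nothing.
  have hn : n ≠ 0 := NeZero.ne n
  obtain ⟨N, rfl⟩ := Nat.exists_eq_succ_of_ne_zero hn
  calc ((Finset.univ.filter fun ω : Choices (N + 1) => bad ω.pivot ω.label).card : ℝ)
      ≤ (N ! : ℝ) * T.card := by exact_mod_cast h2
    _ ≤ (N ! : ℝ) * ((N + 1 : ℕ) * 2 * (4 ^ N * η)) := by gcongr; exact hT
    _ = _ := by
        rw [card_choices]
        simp only [Nat.succ_eq_add_one, Nat.add_sub_cancel, Nat.factorial_succ]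
        have : (4 : ℝ) ^ N = 2 ^ N * 2 ^ N := by rw [← mul_pow]; norm_num
        rw [this]
        push_cast
        ring

theorem labelClass_sample (ω : Choices n) (c : Bool) :
    labelClass ω.label ω.pivot (true, xor (ω.coin ω.pivot) c) = ω.sample c := by
  ext t
  simp [labelClass, Choices.label, Choices.sample, and_assoc]

theorem labelClass_buyers (ω : Choices n) (c : Bool) :
    labelClass ω.label ω.pivot (false, c) = ω.buyers c := by
  ext t
  simp only [labelClass, Choices.label, Choices.buyers, Finset.mem_filter, Finset.mem_erase,
    Finset.mem_univ, and_true, true_and, Prod.mk.injEq, decide_eq_false_iff_not, and_iff_right_iff_imp]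
  rintro ⟨h, -⟩ rfl
  exact h ω.pivot_mem_A

end Law

/-! ### Uniform against heterogeneous prices, and fractional top segments -/

section BenchmarkBounds

variable {ι : Type} {v b : ι → ℝ}

theorem uniformRevenue_eq_min (S : Finset ι) (k : ℝ) {p : ℝ} (hp : 0 < p) :
    uniformRevenue v b S k p = min (budgetAt v b S p) (k * p) :=
  uniformRevenue_eq v b S k hp

theorem IsOptimalPrice.OPT_eq {S : Finset ι} {k p : ℝ} (hp : IsOptimalPrice v b S k p) :
    OPT v b S k = uniformRevenue v b S k p := by
  have h : IsGreatest {r | ∃ p : ℝ, 0 < p ∧ r = uniformRevenue v b S k p}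
      (uniformRevenue v b S k p) :=
    ⟨⟨p, hp.1, rfl⟩, by rintro r ⟨p', hp', rfl⟩; exact hp.2 p' hp'⟩
  exact h.csSup_eq

/-- Heterogeneous prices gain at most a factor of two. -/
theorem OPTstar_le_two_mul_OPT (hb : ∀ i, 0 ≤ b i) (hv : ∀ i, 0 ≤ v i) (S : Finset ι) {k : ℝ}
    (hk : 0 < k) (hO : 0 < OPT v b S k) : OPTstar v b S k ≤ 2 * OPT v b S k := by
  obtain ⟨ps, hps⟩ := exists_isOptimalPrice v b S hk.le
  set O := OPT v b S k with hOdef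
  have hmax : ∀ p, 0 < p → min (budgetAt v b S p) (k * p) ≤ O := fun p hp => by
    rw [hOdef, hps.OPT_eq, ← uniformRevenue_eq_min S k hp]
    exact hps.2 p hp
  -- At the smallest value p above O/k one has kp > O, so the optimum can only be respected if the
  -- total budget at p is at most O.
  have hcut : ∑ i ∈ S with O / k < v i, b i ≤ O := by
    rcases (S.filter fun i => O / k < v i).eq_empty_or_nonempty with h | h
    · rw [h, Finset.sum_empty]
      exact hO.le
    · obtain ⟨i, hi, hmin⟩ := Finset.exists_min_image _ v h
      have hi' := (Finset.mem_filter.1 hi).2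
      have hvi : 0 < v i := (div_pos hO hk).trans hi'
      have e : (S.filter fun l => O / k < v l) = S.filter fun l => v i ≤ v l := by
        ext l
        simp only [Finset.mem_filter]
        exact ⟨fun h => ⟨h.1, hmin l (Finset.mem_filter.2 h)⟩, fun h => ⟨h.1, hi'.trans_le h.2⟩⟩
      have h1 := hmax (v i) hvi
      have h2 : O < k * v i := by rwa [div_lt_iff₀' hk] at hi'
      rw [e]
      rcases min_le_iff.1 h1 with h3 | h3
      · exact h3
      · exact absurd h2 (not_lt.2 h3)
  refine csSup_le ⟨0, fun _ => 0, fun _ => 0, fun i _ => ?_, by simpa using hk.le, by simp⟩ ?_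
  · simp [hv i, hb i]
  · rintro r ⟨p, x, h, hx, rfl⟩
    -- Agents above O/k pay at most their budgets, the others at most O/k per item; each group
    -- contributes at most O.
    have hle : ∀ i ∈ S, x i * p i ≤ (if O / k < v i then b i else 0) + x i * (O / k) := by
      intro i hi
      obtain ⟨h1, h2, h3, h4⟩ := h i hi
      have h5 : 0 ≤ x i * (O / k) := mul_nonneg h3 (div_pos hO hk).le
      split_ifs with hi'
      · linarith
      · rw [zero_add]
        exact mul_le_mul_of_nonneg_left (h2.trans (not_lt.1 hi')) h3
    have h6 : (∑ i ∈ S, x i) * (O / k) ≤ O := by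
      calc _ ≤ k * (O / k) := mul_le_mul_of_nonneg_right hx (div_pos hO hk).le
        _ = O := by field_simp
    calc ∑ i ∈ S, x i * p i ≤ ∑ i ∈ S, ((if O / k < v i then b i else 0) + x i * (O / k)) :=
          Finset.sum_le_sum hle
      _ = (∑ i ∈ S with O / k < v i, b i) + (∑ i ∈ S, x i) * (O / k) := by
          rw [Finset.sum_add_distrib, Finset.sum_filter, Finset.sum_mul]
      _ ≤ 2 * O := by linarith

theorem budgetAt_le_of_subset (hb : ∀ i, 0 ≤ b i) {S T : Finset ι} (h : S ⊆ T) {p : ℝ} :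
    budgetAt v b S p ≤ budgetAt v b T p :=
  Finset.sum_le_sum_of_subset_of_nonneg (Finset.filter_subset_filter _ h) fun i _ _ => hb i

/-- The agents of highest values with a prescribed total budget, the marginal agents being counted
fractionally. -/
theorem exists_cut_weights [Fintype ι] (hb : ∀ i, 0 ≤ b i) {T p₀ : ℝ} (hT : 0 < T)
    (hp₀ : T ≤ budgetAt v b Finset.univ p₀) :
    ∃ (q : ℝ) (w : ι → ℝ), (∀ i, 0 ≤ w i) ∧ (∀ i, w i ≤ b i) ∧ ∑ i, w i = T ∧
      (∀ i, q < v i → w i = b i) ∧ ∀ i, v i < q → w i = 0 := by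
  classical
  have hsame : ∀ (U : Finset ι), U.Nonempty → (∀ i l, i ∈ U → v i ≤ v l → l ∈ U) →
      ∃ i ∈ U, budgetAt v b Finset.univ (v i) = ∑ l ∈ U, b l := by
    intro U hU hup
    obtain ⟨i, hi, hmin⟩ := Finset.exists_min_image U v hU
    refine ⟨i, hi, Finset.sum_congr ?_ fun _ _ => rfl⟩
    ext l
    simp only [Finset.mem_filter, Finset.mem_univ, true_and]
    exact ⟨hup i l hi, hmin l⟩
  -- The cut-off is the largest value at which the available budget still reaches T. Strictly above
  -- it the budget is below T, and the agents at the cut-off fill the gap proportionally.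
  set S₀ := Finset.univ.filter fun i => T ≤ budgetAt v b Finset.univ (v i) with hS₀
  have hne : S₀.Nonempty := by
    have h0 : (Finset.univ.filter fun i => p₀ ≤ v i).Nonempty := by
      refine Finset.nonempty_iff_ne_empty.2 fun h => ?_
      rw [budgetAt, h, Finset.sum_empty] at hp₀
      exact absurd hT (not_lt.2 hp₀)
    obtain ⟨i, -, hi⟩ := hsame _ h0 (by
      simp only [Finset.mem_filter, Finset.mem_univ, true_and]
      exact fun i l h1 h2 => h1.trans h2)
    exact ⟨i, Finset.mem_filter.2 ⟨Finset.mem_univ _, hi ▸ hp₀⟩⟩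
  obtain ⟨i₁, hi₁, hmax⟩ := Finset.exists_max_image S₀ v hne
  set q := v i₁ with hq
  have hqT : T ≤ budgetAt v b Finset.univ q := (Finset.mem_filter.1 hi₁).2
  set a := ∑ i with q < v i, b i with ha
  set e := ∑ i with v i = q, b i with he
  have haT : a < T := by
    rcases (Finset.univ.filter fun i => q < v i).eq_empty_or_nonempty with h | h
    · rw [ha, h, Finset.sum_empty]
      exact hT
    · obtain ⟨i, hi, hi'⟩ := hsame (Finset.univ.filter fun i => q < v i) h (by
        simp only [Finset.mem_filter, Finset.mem_univ, true_and]
        exact fun i l h1 h2 => h1.trans_le h2)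
      by_contra hc
      have := hmax i (Finset.mem_filter.2 ⟨Finset.mem_univ _, by rw [hi']; exact not_lt.1 hc⟩)
      exact absurd (Finset.mem_filter.1 hi).2 (not_lt.2 this)
  have hae : budgetAt v b Finset.univ q = a + e := by
    rw [budgetAt, ha, he, Finset.sum_filter, Finset.sum_filter, Finset.sum_filter,
      ← Finset.sum_add_distrib]
    refine Finset.sum_congr rfl fun i _ => ?_
    rcases lt_trichotomy (v i) q with h | h | h
    · simp [h.not_ge, h.not_gt, h.ne]
    · simp [h]
    · simp [h.le, h, h.ne']
  have he0 : 0 < e := by linarith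
  have hs0 : 0 ≤ (T - a) / e := div_nonneg (by linarith) he0.le
  have hs1 : (T - a) / e ≤ 1 := (div_le_one he0).2 (by linarith)
  refine ⟨q, fun i => (if q < v i then b i else 0) + (T - a) / e * (if v i = q then b i else 0),
    fun i => ?_, fun i => ?_, ?_, fun i hi => ?_, fun i hi => ?_⟩
  · have h0 := hb i
    exact add_nonneg (by split_ifs <;> simp [h0]) (mul_nonneg hs0 (by split_ifs <;> simp [h0]))
  · have h0 := hb i
    rcases lt_trichotomy (v i) q with h | h | h
    · simp [h.not_gt, h.ne, h0]
    · simp only [h, lt_irrefl, if_false, if_true, zero_add]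
      exact mul_le_of_le_one_left h0 hs1
    · simp [h, h.ne']
  · rw [Finset.sum_add_distrib, ← Finset.sum_filter, ← Finset.mul_sum, ← Finset.sum_filter, ← ha,
      ← he, div_mul_cancel₀ _ he0.ne']
    ring
  · simp [hi, hi.ne']
  · simp [hi.not_gt, hi.ne]

end BenchmarkBounds

/-! ### One profitable side, and the probability that both are profitable -/

section MainArgument

/-- If z ≥ 1/10, the bound is at least 0.095 κ ≥ 0.095 O/6 > O/64. If z < 1/10 and CK is the
maximum, then CH < CK/5, which contradicts CH > M/6 and CH + CK ≤ M. If κ is the maximum, the bound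
is κz(1 - z/2) with κz = CH/2 > M/12 ≥ 0.02 O. -/
theorem lt_side_revenue {κ CH CK M O β : ℝ} (hO : 0 < O) (hκ : O / 6 ≤ κ) (hβ : 100 * β ≤ O)
    (hM : O / 4 - β ≤ M) (hH : M / 6 < CH) (hHK : CH + CK ≤ M) :
    O / 64 < κ / 2 * (1 - max 0 (1 - CH / (2 * max CK κ)) ^ 2) := by
  have hκ0 : 0 < κ := by linarith
  have hmax : 0 < max CK κ := hκ0.trans_le (le_max_right _ _)
  set z := CH / (2 * max CK κ) with hz
  have hzm : z * max CK κ = CH / 2 := by rw [hz]; field_simp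
  rcases le_or_gt (1 / 10) z with h | h
  · have h1 : max 0 (1 - z) ^ 2 ≤ (9 / 10) ^ 2 :=
      pow_le_pow_left₀ (le_max_left _ _) (max_le (by norm_num) (by linarith)) 2
    nlinarith
  · rcases max_choice CK κ with h1 | h1
    · rw [h1] at hzm hmax
      nlinarith
    · rw [h1] at hzm
      have hz0 : 0 < z := by
        have : 0 < CH := by linarith
        by_contra hc
        nlinarith
      rw [max_eq_right (by linarith)]
      nlinarith

variable {n : ℕ} [NeZero n] {v b : Fin n → ℝ}

/-- If the random choices are well balanced, the side `c` of the market is profitable. -/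
theorem lt_side_of_balanced (hb : ∀ i, 0 ≤ b i) {P : Finset (Fin n) → ℝ} {k O β : ℝ}
    (hP : ∀ S, IsOptimalPrice v b S k (P S)) (hO : 0 < O) (hβ : 100 * β ≤ O) (hbβ : ∀ i, b i ≤ β)
    {ps q : ℝ} (hps : 0 < ps) (hkps : O / 6 ≤ k * ps) {w₁ w₂ : Fin n → ℝ}
    (hw₁ : ∀ t, w₁ t ≤ if ps ≤ v t then b t else 0)
    (hw₂0 : ∀ t, 0 ≤ w₂ t) (hw₂ : ∀ t, w₂ t ≤ b t) (hw₂T : ∑ t, w₂ t = 5 / 12 * O)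
    (hqb : ∀ t, q < v t → w₂ t = b t) (hq0 : ∀ t, v t < q → w₂ t = 0)
    (ω : Choices n) (c : Bool)
    (h1 : O / 6 < ∑ t ∈ ω.sample (!c), w₁ t)
    (h2 : ∑ t ∈ ω.sample (!c), w₂ t < O / 6)
    (h3 : O / 4 - β ≤ ∑ t ∈ Finset.univ.erase ω.pivot \ ω.sample (!c),
        (if P (ω.sample !c) ≤ v t then b t else 0) →
      (∑ t ∈ Finset.univ.erase ω.pivot \ ω.sample (!c),
        (if P (ω.sample !c) ≤ v t then b t else 0)) / 6 <
      ∑ t ∈ ω.buyers c, if P (ω.sample !c) ≤ v t then b t else 0) :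
    O / 6 ≤ k * P (ω.sample !c) ∧
    O / 64 < k * P (ω.sample !c) / 2 *
      (1 - max 0 (1 - budgetAt v b (ω.buyers c) (P (ω.sample !c)) /
        (2 * max (budgetAt v b (ω.sample c) (P (ω.sample !c))) (k * P (ω.sample !c)))) ^ 2) := by
  set Q := ω.sample (!c) with hQ
  set p := P Q with hp
  set N := Finset.univ.erase ω.pivot with hN
  have hp0 : 0 < p := (hP Q).1
  have hif : ∀ S : Finset (Fin n), ∑ t ∈ S, (if p ≤ v t then b t else 0) = budgetAt v b S p :=
    fun S => (Finset.sum_filter _ _).symm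
  simp only [hif] at h3
  -- The optimal price for Q earns at least as much from Q as the price `ps` does.
  have hrev : O / 6 ≤ min (budgetAt v b Q p) (k * p) := by
    rw [← uniformRevenue_eq_min Q k hp0]
    refine le_trans ?_ ((hP Q).2 ps hps)
    rw [uniformRevenue_eq_min Q k hps]
    refine le_min (h1.le.trans ?_) hkps
    rw [budgetAt, Finset.sum_filter]
    exact Finset.sum_le_sum fun t _ => hw₁ t
  obtain ⟨hQp, hkp⟩ := le_min_iff.1 hrev
  refine ⟨hkp, ?_⟩
  -- Were p above the cut-off, all agents of Q who can afford p would count fully in `w₂`, giving Q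
  -- weight at least O/6.
  have hpq : p ≤ q := by
    by_contra hc
    refine absurd (hQp.trans ?_) (not_le.2 h2)
    rw [← hif]
    refine Finset.sum_le_sum fun t _ => ?_
    split_ifs with ht
    · exact (hqb t ((not_le.1 hc).trans_le ht)).ge
    · exact hw₂0 t
  -- Of the weight 5O/12, less than O/6 lies in Q and at most β on the pivot. As p ≤ q, everyone who
  -- carries weight can afford p.
  have hM : O / 4 - β ≤ budgetAt v b (N \ Q) p := by
    have hQN : Q ⊆ N := by
      intro t ht
      exact Finset.mem_erase.2
        ⟨(Finset.mem_erase.1 (Finset.mem_filter.1 ht).1).1, Finset.mem_univ _⟩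
    have e1 := Finset.sum_sdiff hQN (f := w₂)
    have e2 := Finset.add_sum_erase Finset.univ w₂ (Finset.mem_univ ω.pivot)
    have e3 : ∑ t ∈ N \ Q, w₂ t ≤ budgetAt v b (N \ Q) p := by
      rw [← hif]
      refine Finset.sum_le_sum fun t _ => ?_
      split_ifs with ht
      · exact hw₂ t
      · exact (hq0 t ((not_le.1 ht).trans_le hpq)).le
    have e4 := (hw₂ ω.pivot).trans (hbβ _)
    rw [← hN] at e2
    linarith
  refine lt_side_revenue hO hkp hβ hM (h3 hM) ?_
  have hdisj : Disjoint (ω.buyers c) (ω.sample c) := by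
    rw [Finset.disjoint_left]
    intro t ht ht'
    exact (Finset.mem_filter.1 ht).2.1 (Finset.mem_of_mem_erase (Finset.mem_filter.1 ht').1)
  have hsub : ω.buyers c ∪ ω.sample c ⊆ N \ Q := by
    intro t ht
    simp only [hN, hQ, Choices.sample, Choices.buyers, Finset.mem_union, Finset.mem_filter,
      Finset.mem_sdiff, Finset.mem_erase, Finset.mem_univ, true_and, and_true, ne_eq] at ht ⊢
    rcases ht with ⟨h4, -⟩ | ⟨⟨h4, -⟩, h5⟩
    · exact ⟨fun h => h4 (h ▸ ω.pivot_mem_A), fun h => h4 h.1.2⟩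
    · refine ⟨h4, fun h => ?_⟩
      have := h5.symm.trans h.2
      simp at this
  calc budgetAt v b (ω.buyers c) p + budgetAt v b (ω.sample c) p
      = budgetAt v b (ω.buyers c ∪ ω.sample c) p := by
        simp only [← hif]
        exact (Finset.sum_union hdisj).symm
    _ ≤ _ := budgetAt_le_of_subset hb hsub

/-- The probability of a low revenue in a large market. -/
theorem card_low_revenue_le (hb : ∀ i, 0 ≤ b i) {P : Finset (Fin n) → ℝ} {m : ℕ} (hm : 0 < m)
    (hm4 : 4 ∣ m) (hP : ∀ S, IsOptimalPrice v b S ((m : ℝ) / 4) (P S)) {O β : ℝ}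
    (hOdef : O = OPT v b Finset.univ m) (hO : 0 < O) (hβ0 : 0 < β) (hβ : 100 * β ≤ O)
    (hbβ : ∀ i, b i ≤ β) (a d : Fin n → ℝ)
    [DecidablePred fun ω : Choices n => ¬ O / 32 < revIndiv ω P v b m a d] :
    ((Finset.univ.filter fun ω : Choices n => ¬ O / 32 < revIndiv ω P v b m a d).card : ℝ) ≤
      Fintype.card (Choices n) * (6 * Real.exp (-(O / (144 * β)))) := by
  classical
  have hm' : (0 : ℝ) < m := by exact_mod_cast hm
  obtain ⟨ps, hps⟩ := exists_isOptimalPrice v b Finset.univ hm'.le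
  have hOps : O = min (budgetAt v b Finset.univ ps) (m * ps) := by
    rw [hOdef, hps.OPT_eq, uniformRevenue_eq_min _ _ hps.1]
  set C := budgetAt v b Finset.univ ps with hC
  have hOC : O ≤ C := hOps.le.trans (min_le_left _ _)
  have hOm : O ≤ m * ps := hOps.le.trans (min_le_right _ _)
  have hC0 : 0 < C := hO.trans_le hOC
  have hOC1 : O / C ≤ 1 := (div_le_one hC0).2 hOC
  set w₁ : Fin n → ℝ := fun t => O / C * if ps ≤ v t then b t else 0 with hw₁
  have hif0 : ∀ (r : ℝ) t, 0 ≤ if r ≤ v t then b t else 0 := fun r t => by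
    split_ifs
    exacts [hb t, le_rfl]
  have hifβ : ∀ (r : ℝ) t, (if r ≤ v t then b t else 0) ≤ β := fun r t => by
    split_ifs
    exacts [hbβ t, hβ0.le]
  have hw₁0 : ∀ t, 0 ≤ w₁ t := fun t => mul_nonneg (div_pos hO hC0).le (hif0 ps t)
  have hw₁le : ∀ t, w₁ t ≤ if ps ≤ v t then b t else 0 := fun t =>
    mul_le_of_le_one_left (hif0 ps t) hOC1
  have hw₁β : ∀ t, w₁ t ≤ β := fun t => (hw₁le t).trans (hifβ ps t)
  have hw₁T : ∑ t, w₁ t = O := by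
    rw [hw₁, ← Finset.mul_sum, ← Finset.sum_filter]
    exact div_mul_cancel₀ _ hC0.ne'
  -- 5/12 is small enough for a quarter of it to stay below 1/6, and large enough to leave 5/12 -
  -- 1/6 = 1/4 outside Q.
  obtain ⟨q, w₂, hw₂0, hw₂b, hw₂T, hqb, hq0⟩ := exists_cut_weights (v := v) hb
    (T := 5 / 12 * O) (p₀ := ps) (by linarith) (by linarith)
  have hw₂β : ∀ t, w₂ t ≤ β := fun t => (hw₂b t).trans (hbβ t)
  set w₃ : Finset (Fin n) → Fin n → ℝ := fun U t => if P U ≤ v t then b t else 0 with hw₃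
  set η := Real.exp (-(O / (144 * β))) with hη
  -- The label of the price-setting part for side `c`. It depends on the pivot's own coin, which is
  -- constant once the pivot's label is pinned.
  let x : Bool → Fin n → (Fin n → Bool × Bool) → Bool × Bool := fun c j l =>
    (true, xor (l j).2 (!c))
  let bad₁ : Bool → Fin n → (Fin n → Bool × Bool) → Prop := fun c j l =>
    ∑ t ∈ labelClass l j (x c j l), w₁ t ≤ O / 6
  let bad₂ : Bool → Fin n → (Fin n → Bool × Bool) → Prop := fun c j l =>
    O / 6 ≤ ∑ t ∈ labelClass l j (x c j l), w₂ t
  let bad₃ : Bool → Fin n → (Fin n → Bool × Bool) → Prop := fun c j l =>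
    O / 4 - β ≤ ∑ t ∈ Finset.univ.erase j \ labelClass l j (x c j l),
      w₃ (labelClass l j (x c j l)) t ∧
    ∑ t ∈ labelClass l j (false, c), w₃ (labelClass l j (x c j l)) t ≤
      (∑ t ∈ Finset.univ.erase j \ labelClass l j (x c j l),
        w₃ (labelClass l j (x c j l)) t) / 6
  have hx : ∀ c j c', ∀ l ∈ Fintype.piFinset (pinned j (true, c')),
      x c j l = (true, xor c' (!c)) := by
    intro c j c' l hl
    simp only [x, mem_piFinset_pinned.1 hl]
  have hlab₁ := fun j x₀ x => card_labelClass_lower j x₀ hβ0 hw₁0 hw₁β x hβ (by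
    have := Finset.add_sum_erase Finset.univ w₁ (Finset.mem_univ j)
    linarith [hw₁β j])
  have hlab₂ := fun j x₀ x => card_labelClass_upper j x₀ hβ0 hw₂0 hw₂β x hO (by
    have := Finset.add_sum_erase Finset.univ w₂ (Finset.mem_univ j)
    linarith [hw₂0 j])
  have hlab₃ := fun j x₀ x z (hxz : z ≠ x) => card_labelClass_share j x₀ hβ0 (w := w₃)
    (fun U t => hif0 _ t) (fun U t => hifβ _ t) hxz hβ
  have hb₁ : ∀ c, ((Finset.univ.filter fun ω : Choices n => bad₁ c ω.pivot ω.label).card : ℝ) ≤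
      Fintype.card (Choices n) * η := by
    refine fun c => card_bad_le (bad₁ c) fun j c' => ?_
    refine le_trans (Nat.cast_le.2 (Finset.card_le_card fun l hl => ?_)) (hlab₁ j (true, c')
      (true, xor c' (!c)))
    obtain ⟨h1, h2⟩ := Finset.mem_filter.1 hl
    simp only [bad₁, hx c j c' l h1] at h2
    exact Finset.mem_filter.2 ⟨h1, h2⟩
  have hb₂ : ∀ c, ((Finset.univ.filter fun ω : Choices n => bad₂ c ω.pivot ω.label).card : ℝ) ≤
      Fintype.card (Choices n) * η := by
    refine fun c => card_bad_le (bad₂ c) fun j c' => ?_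
    refine le_trans (Nat.cast_le.2 (Finset.card_le_card fun l hl => ?_)) (hlab₂ j (true, c')
      (true, xor c' (!c)))
    obtain ⟨h1, h2⟩ := Finset.mem_filter.1 hl
    simp only [bad₂, hx c j c' l h1] at h2
    exact Finset.mem_filter.2 ⟨h1, h2⟩
  have hb₃ : ∀ c, ((Finset.univ.filter fun ω : Choices n => bad₃ c ω.pivot ω.label).card : ℝ) ≤
      Fintype.card (Choices n) * η := by
    refine fun c => card_bad_le (bad₃ c) fun j c' => ?_
    refine le_trans (Nat.cast_le.2 (Finset.card_le_card fun l hl => ?_)) (hlab₃ j (true, c')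
      (true, xor c' (!c)) (false, c) (by simp))
    obtain ⟨h1, h2⟩ := Finset.mem_filter.1 hl
    simp only [bad₃, hx c j c' l h1] at h2
    exact Finset.mem_filter.2 ⟨h1, h2⟩
  let B : Bool → Finset (Choices n) := fun c =>
    (Finset.univ.filter fun ω : Choices n => bad₁ c ω.pivot ω.label) ∪
    (Finset.univ.filter fun ω : Choices n => bad₂ c ω.pivot ω.label) ∪
    (Finset.univ.filter fun ω : Choices n => bad₃ c ω.pivot ω.label)
  have hB : ∀ c, ((B c).card : ℝ) ≤ Fintype.card (Choices n) * (3 * η) := by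
    intro c
    have h1 : (B c).card ≤ _ + _ + _ := (Finset.card_union_le _ _).trans
      (Nat.add_le_add_right (Finset.card_union_le _ _) _)
    have h2 : ((B c).card : ℝ) ≤ _ := Nat.cast_le.2 h1
    push_cast at h2
    linarith [hb₁ c, hb₂ c, hb₃ c]
  have hsub : (Finset.univ.filter fun ω : Choices n => ¬ O / 32 < revIndiv ω P v b m a d) ⊆
      B true ∪ B false := by
    intro ω hω
    by_contra hnB
    refine (Finset.mem_filter.1 hω).2 ?_
    have hgood : ∀ c, ω ∉ B c := by
      intro c hc
      refine hnB (Finset.mem_union.2 ?_)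
      cases c
      exacts [Or.inr hc, Or.inl hc]
    have hk : ((m / 4 : ℕ) : ℝ) = (m : ℝ) / 4 := by
      rw [Nat.cast_div hm4 (by norm_num)]
      norm_num
    have hbal : ∀ c, _ ∧ _ := fun c => by
      have hc := hgood c
      simp only [B, Finset.mem_union, Finset.mem_filter, Finset.mem_univ, true_and, not_or] at hc
      obtain ⟨⟨h1, h2⟩, h3⟩ := hc
      have hxω : labelClass ω.label ω.pivot (x c ω.pivot ω.label) = ω.sample (!c) :=
        labelClass_sample ω (!c)
      simp only [bad₁, bad₂, bad₃, hxω, labelClass_buyers, not_le, not_and] at h1 h2 h3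
      exact lt_side_of_balanced hb hP hO hβ hbβ hps.1 (by linarith) hw₁le hw₂0 hw₂b hw₂T hqb hq0
        ω c h1 h2 h3
    refine lt_of_lt_of_le ?_ (le_revIndiv (r := fun c => _) ω hb (fun S => (hP S).1)
      fun c s hs => le_expect_pay_side ω hb (Nat.div_pos (Nat.le_of_dvd hm hm4) (by norm_num))
        (fun S => (hP S).1) c (fun i => ?_) hs)
    · rw [hk]
      linarith [(hbal true).2, (hbal false).2]
    -- No single demand exceeds the k items of a side: b i ≤ β ≤ O/100 < O/6 ≤ kp.
    · rw [hk]
      linarith [(hbal c).1, hbβ i]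
  have h1 : ((Finset.univ.filter fun ω : Choices n => ¬ O / 32 < revIndiv ω P v b m a d).card : ℝ)
      ≤ (B true).card + (B false).card := by
    exact_mod_cast (Finset.card_le_card hsub).trans (Finset.card_union_le _ _)
  linarith [hB true, hB false]

end MainArgument

end OnlineAuction

/-! ### Reduction of the stated probability to the large-market bound -/

theorem mainTheorem3 (n : ℕ) [NeZero n] (m : ℕ) (hm : 0 < m) (hm4 : 4 ∣ m)
    (a d v b : Fin n → ℝ) (ha : StrictMono a) (had : ∀ i, a i ≤ d i)
    (hv : ∀ i, 0 ≤ v i) (hb : ∀ i, 0 ≤ b i) (hpos : ∃ i, 0 < v i ∧ 0 < b i)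
    (P : Finset (Fin n) → ℝ)
    (hP : ∀ S, IsOptimalPrice v b S ((m : ℝ) / 4) (P S))
    (δ : ℝ) (hδ : δ ∈ Set.Icc (0 : ℝ) (1 / 3)) :
    (1 - 1 / (n : ℝ))
        * max 0 (1 - 2 * Real.exp (-(1 / (32 * marketEps v b Finset.univ m))))
        * max 0 (1 - 4 * Real.exp (-(δ ^ 2 / (32 * marketEps v b Finset.univ m))))
      ≤ prob (choicesDist n)
          {ω | (1 - 3 * δ) * OPTstar v b Finset.univ m / 64 < revIndiv ω P v b m a d} := by
  classical
  have hm' : (0 : ℝ) < m := by exact_mod_cast hm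
  obtain ⟨i₀, hvi, hbi⟩ := hpos
  set O := OPT v b Finset.univ m with hOdef
  set β := maxBudget b Finset.univ with hβdef
  have hbβ : ∀ i, b i ≤ β := fun i =>
    le_csSup ((Finset.finite_toSet _).image b).bddAbove ⟨i, by simp, rfl⟩
  have hβ0 : 0 < β := hbi.trans_le (hbβ i₀)
  have hO : 0 < O := by
    obtain ⟨ps, hps⟩ := exists_isOptimalPrice v b Finset.univ hm'.le
    rw [hOdef, hps.OPT_eq]
    refine lt_of_lt_of_le ?_ (hps.2 (v i₀) hvi)
    rw [uniformRevenue_eq _ _ _ _ hvi]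
    refine lt_min (hbi.trans_le ?_) (mul_pos hm' hvi)
    exact Finset.single_le_sum (f := b) (fun i _ => hb i) (by simp)
  have hε : marketEps v b Finset.univ m = β / O := rfl
  rw [hε]
  set x := δ ^ 2 / (32 * (β / O)) with hx
  have hprob : ∀ E : Set (Choices n), 0 ≤ prob (choicesDist n) E := fun _ =>
    ENNReal.toReal_nonneg
  -- If the last factor is zero there is nothing to prove; otherwise exp(-x) < 1/4 makes the market
  -- large.
  rcases le_or_gt 1 (4 * Real.exp (-x)) with hy | hy
  · rw [max_eq_left (by linarith : 1 - 4 * Real.exp (-x) ≤ 0), mul_zero]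
    exact hprob _
  have hδ2 : δ ^ 2 ≤ 1 / 9 := by
    have := hδ.1
    have := hδ.2
    nlinarith
  have hx' : x = δ ^ 2 * (O / (32 * β)) := by
    rw [hx]; field_simp
  have hOβ : 0 < O / (32 * β) := by positivity
  have hxle : x ≤ O / (288 * β) := by
    have e : O / (288 * β) = 1 / 9 * (O / (32 * β)) := by field_simp; norm_num
    rw [hx', e]
    gcongr
  -- From 1 - x ≤ exp(-x) < 1/4. Since δ² ≤ 1/9 gives x ≤ O/(288β), this means O > 216β.
  have hx34 : 3 / 4 < x := by
    have := Real.add_one_le_exp (-x)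
    linarith
  have hβO : 100 * β ≤ O := by
    have h1 : 3 / 4 < O / (288 * β) := hx34.trans_le hxle
    rw [lt_div_iff₀ (by positivity)] at h1
    linarith
  have hlow := card_low_revenue_le hb hm hm4 hP hOdef hO hβ0 hβO hbβ a d
  -- The rate 1/144 is twice 1/288, so the left side is 6 times a square; one of its factors is
  -- below 1/4 and absorbs the constant.
  have hexp : 6 * Real.exp (-(O / (144 * β))) ≤ 4 * Real.exp (-x) := by
    have e : -(O / (144 * β)) = -(O / (288 * β)) + -(O / (288 * β)) := by field_simp; ring
    have h1 : Real.exp (-(O / (288 * β))) ≤ Real.exp (-x) := Real.exp_le_exp.2 (by linarith)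
    have h2 := Real.exp_pos (-(O / (288 * β)))
    rw [e, Real.exp_add]
    nlinarith
  have hpos : (0 : ℝ) < Fintype.card (Choices n) := by exact_mod_cast Fintype.card_pos
  have hn : (1 : ℝ) ≤ n := by exact_mod_cast Nat.one_le_iff_ne_zero.2 (NeZero.ne n)
  have hn1 : 1 / (n : ℝ) ≤ 1 := (div_le_one (by linarith)).2 hn
  have hn0 : 0 ≤ 1 / (n : ℝ) := by positivity
  calc _ ≤ 1 * 1 * max 0 (1 - 4 * Real.exp (-x)) := by
        refine mul_le_mul_of_nonneg_right (mul_le_mul (by linarith) ?_ (le_max_left _ _)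
          zero_le_one) (le_max_left _ _)
        exact max_le zero_le_one (by
          linarith [Real.exp_pos (-(1 / (32 * (β / O))))])
    _ = 1 - 4 * Real.exp (-x) := by rw [max_eq_right (by linarith)]; ring
    _ ≤ _ := by
        rw [prob_choicesDist]
        refine sub_le_sub_left ?_ _
        rw [div_le_iff₀ hpos]
        calc _ ≤ ((Finset.univ.filter fun ω : Choices n =>
              ¬ O / 32 < revIndiv ω P v b m a d).card : ℝ) := by
              refine Nat.cast_le.2 (Finset.card_le_card ?_)
              refine Finset.monotone_filter_right _ fun ω _ hω hlt => hω ?_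
              have h1 := OPTstar_le_two_mul_OPT (v := v) hb hv Finset.univ hm' hO
              have h2 : (1 - 3 * δ) * OPTstar v b Finset.univ m ≤ 2 * O := by
                have h3 : 0 ≤ 1 - 3 * δ := by linarith [hδ.2]
                have h4 : 1 - 3 * δ ≤ 1 := by linarith [hδ.1]
                calc _ ≤ (1 - 3 * δ) * (2 * O) := mul_le_mul_of_nonneg_left h1 h3
                  _ ≤ 1 * (2 * O) := mul_le_mul_of_nonneg_right h4 (by linarith)
                  _ = _ := one_mul _
              show (1 - 3 * δ) * OPTstar v b Finset.univ m / 64 < revIndiv ω P v b m a d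
              linarith
          _ ≤ _ := hlow
          _ ≤ 4 * Real.exp (-x) * Fintype.card (Choices n) := by
              rw [mul_comm]
              gcongr
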